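/- Let $\mathcal U=[-1,1]^{\mathbb N}$ carry the uniform (infinite product) probability measure $\varrho$. For $\rho\ge 1$ let $\mathcal E(\rho)=\{(z+z^{-1})/2 : z\in\mathbb C,\ 1\le|z|\le\rho\}$ be the Bernstein ellipse (so $\mathcal E(1)=[-1,1]$), and for $\boldsymbol b\in[0,\infty)^{\mathbb N}$ let $$\mathcal R(\boldsymbol b)=\bigcup\Big\{\prod_{j}\mathcal E(\rho_j) : \rho_j\ge 1\ \forall j,\ \sum_{j=1}^{\infty}\Big(\tfrac{\rho_j+\rho_j^{-1}}{2}-1\Big)b_j\le 1\Big\}\subset\mathbb C^{\mathbb N}.$$ Let $\mathcal H(\boldsymbol b)$ be the set of functions $f:\mathcal U\to\mathbb R$ that have a complex-valued extension which is complex differentiable with respect to each variable at every point of $\mathcal R(\boldsymbol b)$ and is bounded by $1$ in absolute value on $\mathcal R(\boldsymbol b)$. For a set $\Theta\subset\mathbb N$ with $|\Theta|=s$ let $\mathcal T_\Theta(\boldsymbol y)=(y_i)_{i\in\Theta}\in\mathbb R^s$. A tanh DNN $\Phi:\mathbb R^{n}\to\mathbb R^{k}$ is a map $\Phi=\mathcal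 A_{D+1}\circ\tanh\circ\mathcal A_D\circ\cdots\circ\tanh\circ\mathcal A_0$ with affine $\mathcal A_l:\mathbb R^{N_l}\to\mathbb R^{N_{l+1}}$, $N_0=n$, $N_{D+2}=k$, and $\tanh$ acting componentwise. The class $\mathcal N$ of all such maps with a fixed architecture $(D;N_1,\dots,N_{D+1})$ has width $\max\{N_1,\dots,N_{D+1}\}$ and depth $D$. Theorem (existence theorem for DNNs). There are universal constants $c_1,c_2>0$ such that the following holds. Let $0<p<1$ and let $\boldsymbol b\in[0,\infty)^{\mathbb N}$ with $\boldsymbol b\in\ell^p(\mathbb N)$. Then there is a constant $C(\boldsymbol b,p)$ such that for every $s\in\mathbb N=\{1,2,\dots\}$ there are a set $\Theta\subset\mathbb N$ with $|\Theta|=s$ and a class $\mathcal N$ of tanh DNNs $\Phi:\mathbb R^s\to\mathbb R$ of a fixed architecture with $$\mathrm{width}(\mathcal N)\le c_1 s^2,\qquad \mathrm{depth}(\mathcal N)\le c_2\log s,$$ such that for every ($\varrho$-measurable) $f\in\mathcal H(\boldsymbol b)$ there is a $\Phi\in\mathcal N$ with $$\|f-\Phi\circ\mathcal T_\Theta\|_{L^2_\varrho(\mathcal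 U)}\le C(\boldsymbol b,p)\, s^{\frac12-\frac1p}.$$ If, moreover, the minimal monotone majorant $\tilde b_i=\sup_{j\ge i}|b_j|$ of $\boldsymbol b$ belongs to $\ell^p(\mathbb N)$, then $\Theta=\{1,\dots,s\}$, that is, $\mathcal T_\Theta$ is the restriction to the first $s$ coordinates. -/

import Mathlib

open MeasureTheory Set
open scoped ENNReal

noncomputable section

namespace HoloDNN

/-! ### The parameter domain and its uniform probability measure -/

/-- The domain `[-1,1]^ℕ`. -/
abbrev Cube : Type := ℕ → Icc (-1 : ℝ) 1

/-- The uniform probability measure on `[-1,1]`. -/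
def unif : Measure (Icc (-1 : ℝ) 1) :=
  (2 : ℝ≥0∞)⁻¹ • (volume : Measure ℝ).comap Subtype.val

instance : IsProbabilityMeasure unif := by
  constructor
  have h : (volume : Measure ℝ).comap (Subtype.val : Icc (-1 : ℝ) 1 → ℝ) univ = 2 := by
    rw [comap_subtype_coe_apply measurableSet_Icc, image_univ, Subtype.range_coe, Real.volume_Icc]
    norm_num
  rw [unif, Measure.smul_apply, h, smul_eq_mul]
  exact ENNReal.inv_mul_cancel (by norm_num) (by norm_num)

/-- The uniform probability measure on `[-1,1]^ℕ`. -/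
def rho : Measure Cube := Measure.infinitePi fun _ => unif

/-! ### Holomorphic functions of infinitely many variables -/

/-- `F` is holomorphic with respect to each variable at every point of `O`: for all `z ∈ O` and
all `j`, the limit of `(F (z + h e_j) - F z) / h` as `h → 0`, `h ∈ ℂ`, exists. -/
def HolomorphicIn (O : Set (ℕ → ℂ)) (F : (ℕ → ℂ) → ℂ) : Prop :=
  ∀ z ∈ O, ∀ j : ℕ, DifferentiableAt ℂ (fun h : ℂ => F (z + Pi.single j h)) 0

/-- The Bernstein ellipse with parameter `r ≥ 1`; for `r = 1` it is the segment `[-1,1]`. -/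
def bernsteinEllipse (r : ℝ) : Set ℂ :=
  {w | ∃ z : ℂ, 1 ≤ ‖z‖ ∧ ‖z‖ ≤ r ∧ w = (z + z⁻¹) / 2}

/-- The Bernstein polyellipse, a product of Bernstein ellipses. -/
def polyellipse (r : ℕ → ℝ) : Set (ℕ → ℂ) :=
  {w | ∀ j, w j ∈ bernsteinEllipse (r j)}

/-- The union of all polyellipses with parameter `r ≥ 1` such that
`∑ j, ((r j + 1 / r j) / 2 - 1) * b j` converges and is at most `ε`. -/
def region (b : ℕ → ℝ) (ε : ℝ) : Set (ℕ → ℂ) :=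
  {w | ∃ r : ℕ → ℝ, (∀ j, 1 ≤ r j) ∧
    Summable (fun j => ((r j + (r j)⁻¹) / 2 - 1) * b j) ∧
    ∑' j, ((r j + (r j)⁻¹) / 2 - 1) * b j ≤ ε ∧
    w ∈ polyellipse r}

/-- The class of real-valued functions on `[-1,1]^ℕ` that have a complex-valued extension which
is holomorphic in `region b 1` and bounded there by one in absolute value.

The extension is a function on `ℂ^ℕ` of which only its values along coordinate lines near points
of `region b 1` matter. A function that is holomorphic in an open neighbourhood of the region, for
any topology on `ℂ^ℕ` in which coordinate lines are continuous, is of this kind. -/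
def unitClass (b : ℕ → ℝ) : Set (Cube → ℝ) :=
  {f | ∃ F : (ℕ → ℂ) → ℂ, HolomorphicIn (region b 1) F ∧
    (∀ y : Cube, F (fun j => ((y j : ℝ) : ℂ)) = (f y : ℂ)) ∧
    ∀ z ∈ region b 1, ‖F z‖ ≤ 1}

/-! ### The monotone `ℓ^p` space -/

/-- The minimal monotone majorant `i ↦ sup_{j ≥ i} |z j|` of a bounded sequence. -/
def monotoneMajorant (z : ℕ → ℝ) (i : ℕ) : ℝ := ⨆ j : Ici i, |z j|

/-- `z` is bounded and its minimal monotone majorant is in `ℓ^p`. -/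
def MemMonotoneLp (z : ℕ → ℝ) (p : ℝ) : Prop :=
  Memℓp z ∞ ∧ Memℓp (monotoneMajorant z) (ENNReal.ofReal p)

/-! ### Feedforward neural networks -/

/-- The functions `ℝ^n → ℝ^k` of the form `A_{D+1} ∘ σ ∘ A_D ∘ σ ∘ ⋯ ∘ σ ∘ A_0`, where the `A_l` are
affine, `σ` acts componentwise, and the list holds the widths of the hidden layers in order. -/
def realizations (σ : ℝ → ℝ) (k : ℕ) : (n : ℕ) → List ℕ → Set ((Fin n → ℝ) → (Fin k → ℝ))
  | n, [] => {Φ | ∃ A : (Fin n → ℝ) →ᵃ[ℝ] (Fin k → ℝ), Φ = A}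
  | n, N :: L => {Φ | ∃ A : (Fin n → ℝ) →ᵃ[ℝ] (Fin N → ℝ), ∃ Ψ ∈ realizations σ k N L,
      Φ = fun z => Ψ (fun i => σ (A z i))}

/-- An architecture: the positive widths `N_1, …, N_{D+1}` of the hidden layers, `D ≥ 0`. -/
structure Architecture where
  hidden : List ℕ
  ne_nil : hidden ≠ []
  pos : ∀ N ∈ hidden, 0 < N

/-- `max {N_1, …, N_{D+1}}`. -/
def Architecture.width (a : Architecture) : ℕ := a.hidden.foldr max 0

/-- The number `D`, one less than the number of hidden layers. -/
def Architecture.depth (a : Architecture) : ℕ := a.hidden.length - 1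

/-- The class of tanh networks `ℝ^n → ℝ^k` with a given architecture. -/
def tanhDNN (n k : ℕ) (a : Architecture) : Set ((Fin n → ℝ) → (Fin k → ℝ)) :=
  realizations Real.tanh k n a.hidden

/-- The variable restriction operator `y ↦ (y_i)_{i ∈ Θ}`, the indices in increasing order. -/
def restrictVars (Θ : Finset ℕ) {n : ℕ} (h : Θ.card = n) (y : Cube) : Fin n → ℝ :=
  fun i => (y (Θ.orderEmbOfFin h i) : ℝ)

end HoloDNN

end

/-!
Integrating one variable at a time, and in each variable against a polynomial orthogonal to the
near-best Chebyshev approximation furnished by the Joukowsky map, one finds that the coefficient of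
`f ∈ unitClass b` with index `ν` in an orthonormal basis of tensor polynomials is at most the
infimum of `∏ j, min 1 (2 r_j ^ (-ν_j) / (1 - r_j⁻¹))` over the admissible `r`. A fixed parameter
`κ > 1` for finitely many variables and `r_j` of order `1 + ν_j / (|ν| b_j)` for the others bound
these weights by multinomial terms, so they are `p`-summable. The best `s` of the multi-indices
then leave an `L²` error of order `s ^ (1/2 - 1/p)` (Stechkin). As a superlevel set of a decreasing
weight they form a lower set, which has degree less than `s` and involves at most `s` variables; if
`b` is decreasing these can be taken to be the first ones. Replacing `b` by `|b_j| + 2 ^ (-j)`, or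
by its monotone majorant plus `2 ^ (-j)`, makes it strictly positive.

A product of two numbers is a limit of second differences of any activation with a point of nonzero
second derivative, so a monomial of degree at most `s` is a limit of networks arranged as binary
trees of depth `log₂ s`, and `s` such trees in parallel evaluate the polynomial.
-/

namespace HoloDNN

/-! ### Networks that evaluate sparse polynomials -/

section Networks

open Filter Topology

/-- `T` is a uniform limit on bounded sets of networks with activation function `σ` and hidden
widths `L`. -/
def Approximable (σ : ℝ → ℝ) (n k : ℕ) (L : List ℕ) (T : (Fin n → ℝ) → (Fin k → ℝ)) : Prop :=
  ∀ R ε : ℝ, 0 < ε → ∃ Φ ∈ realizations σ k n L, ∀ x, ‖x‖ ≤ R → ‖Φ x - T x‖ ≤ ε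

/-- The second symmetric difference quotients of `σ` have a nonzero limit at some point. Such an
activation function can imitate squaring, hence multiplication. -/
def HasNonzeroCurvature (σ : ℝ → ℝ) : Prop :=
  ∃ a c : ℝ, c ≠ 0 ∧ Tendsto (fun t => (σ (a + t) + σ (a - t) - 2 * σ a) / t ^ 2) (𝓝[≠] 0) (𝓝 c)

variable {σ : ℝ → ℝ}

theorem realizations_comp_affine {k n m : ℕ} {L : List ℕ} {Ψ : (Fin n → ℝ) → (Fin k → ℝ)}
    (hΨ : Ψ ∈ realizations σ k n L) (A : (Fin m → ℝ) →ᵃ[ℝ] (Fin n → ℝ)) :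
    (fun x => Ψ (A x)) ∈ realizations σ k m L := by
  cases L with
  | nil =>
    obtain ⟨B, rfl⟩ := hΨ
    exact ⟨B.comp A, rfl⟩
  | cons N L =>
    obtain ⟨B, Ξ, hΞ, rfl⟩ := hΨ
    exact ⟨B.comp A, Ξ, hΞ, rfl⟩

theorem Approximable.comp {n k m N : ℕ} {L : List ℕ} {H : (Fin n → ℝ) → (Fin m → ℝ)}
    {G : (Fin m → ℝ) → (Fin k → ℝ)} (hG : Approximable σ m k L G)
    (hH : Approximable σ n m [N] H) (hGc : Continuous G) (hHc : Continuous H) :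
    Approximable σ n k (N :: L) (fun x => G (H x)) := by
  intro R ε hε
  obtain ⟨R', hR'⟩ := ((isCompact_closedBall (0 : Fin n → ℝ) R).image hHc).isBounded.exists_norm_le
  obtain ⟨Ψ, hΨ, hΨG⟩ := hG (R' + 1) (ε / 2) (by positivity)
  obtain ⟨δ, hδ, hGδ⟩ := Metric.uniformContinuousOn_iff_le.1
    ((isCompact_closedBall (0 : Fin m → ℝ) (R' + 1)).uniformContinuousOn_of_continuous
      hGc.continuousOn) (ε / 2) (by positivity)
  obtain ⟨_, ⟨A, _, ⟨B, rfl⟩, rfl⟩, hΦH⟩ := hH R (min δ 1) (by positivity)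
  refine ⟨_, ⟨A, _, realizations_comp_affine hΨ B, rfl⟩, fun x hx => ?_⟩
  have hHx : ‖H x‖ ≤ R' := hR' _ ⟨x, by simpa using hx, rfl⟩
  set w := B (fun i => σ (A x i))
  have hclose : ‖w - H x‖ ≤ min δ 1 := hΦH x hx
  have hw : ‖w‖ ≤ R' + 1 := by
    linarith [norm_le_norm_add_norm_sub' w (H x), hclose.trans (min_le_right δ 1)]
  have hGw : ‖G w - G (H x)‖ ≤ ε / 2 := by
    simpa only [dist_eq_norm] using hGδ w (by simpa using hw) (H x) (by simp; linarith)
      (by simpa only [dist_eq_norm] using hclose.trans (min_le_left _ _))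
  linarith [norm_sub_le_norm_sub_add_norm_sub (Ψ w) (G w) (G (H x)), hΨG w hw]

theorem HasNonzeroCurvature.exists_approx_sq (hσ : HasNonzeroCurvature σ) (K : ℝ) {ε : ℝ}
    (hε : 0 < ε) : ∃ a h q : ℝ, ∀ u, |u| ≤ K →
      |q * (σ (a + h * u) + σ (a - h * u) - 2 * σ a) - u ^ 2| ≤ ε := by
  obtain ⟨a, c, hc, hlim⟩ := hσ
  set g : ℝ → ℝ := fun t => σ (a + t) + σ (a - t) - 2 * σ a with hg
  have hlim' : Tendsto (fun t => g t / t ^ 2 / c) (𝓝[≠] 0) (𝓝 1) := by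
    simpa only [div_self hc] using hlim.div_const c
  set K' := |K| + 1
  have hK' : 0 < K' := by positivity
  obtain ⟨δ, hδ, hclose⟩ := Metric.tendsto_nhdsWithin_nhds.1 hlim' (ε / K' ^ 2) (by positivity)
  set h := δ / (2 * K') with hh
  have hh0 : 0 < h := by positivity
  refine ⟨a, h, 1 / (c * h ^ 2), fun u hu => ?_⟩
  change |1 / (c * h ^ 2) * g (h * u) - u ^ 2| ≤ ε
  rcases eq_or_ne u 0 with rfl | hu0
  · simpa [hg, two_mul] using hε.le
  have huK : |u| ≤ K' := hu.trans ((le_abs_self K).trans (by simp [K']))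
  have hhu : |h * u| < δ := by
    calc |h * u| = h * |u| := by rw [abs_mul, abs_of_pos hh0]
      _ ≤ h * K' := by gcongr
      _ = δ / 2 := by rw [hh]; field_simp
      _ < δ := by linarith
  have hquot : |g (h * u) / (h * u) ^ 2 / c - 1| ≤ ε / K' ^ 2 := by
    simpa only [Real.dist_eq] using
      (hclose (x := h * u) (mul_ne_zero hh0.ne' hu0) (by simpa using hhu)).le
  calc |1 / (c * h ^ 2) * g (h * u) - u ^ 2|
      = |u ^ 2 * (g (h * u) / (h * u) ^ 2 / c - 1)| := by congr 1; field_simp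
    _ = |u| ^ 2 * |g (h * u) / (h * u) ^ 2 / c - 1| := by rw [abs_mul, abs_pow]
    _ ≤ K' ^ 2 * (ε / K' ^ 2) := by gcongr
    _ = ε := by field_simp

theorem HasNonzeroCurvature.exists_approx_mul (hσ : HasNonzeroCurvature σ) (R : ℝ) {ε : ℝ}
    (hε : 0 < ε) : ∃ a h q : ℝ, ∀ x y : ℝ, |x| ≤ R → |y| ≤ R →
      |q * (σ (a + h * (x + y)) + σ (a - h * (x + y))
        - σ (a + h * (x - y)) - σ (a - h * (x - y))) - x * y| ≤ ε := by
  obtain ⟨a, h, q, hsq⟩ := hσ.exists_approx_sq (2 * R) (ε := 2 * ε) (by positivity)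
  refine ⟨a, h, q / 4, fun x y hx hy => ?_⟩
  have hadd := abs_le.1 (hsq (x + y) ((abs_add_le x y).trans (by linarith)))
  have hsub := abs_le.1 (hsq (x - y) ((abs_sub x y).trans (by linarith)))
  exact abs_le.2 ⟨by linarith, by linarith⟩

theorem hasNonzeroCurvature_tanh : HasNonzeroCurvature Real.tanh := by
  have hsinh : Tendsto (fun t => Real.sinh t / t) (𝓝[≠] 0) (𝓝 1) := by
    simpa [slope_fun_def_field] using (Real.hasDerivAt_sinh 0).tendsto_slope
  have hcoeff : Tendsto (fun t => -Real.sinh 2 / (Real.cosh 1 ^ 2 * (Real.cosh (1 + t) *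
      Real.cosh (1 - t)))) (𝓝[≠] 0) (𝓝 (-Real.sinh 2 / Real.cosh 1 ^ 4)) := by
    have hcont : Continuous fun t : ℝ => -Real.sinh 2 / (Real.cosh 1 ^ 2 *
        (Real.cosh (1 + t) * Real.cosh (1 - t))) :=
      continuous_const.div (by fun_prop) fun t => by positivity [Real.cosh_pos (1 + t)]
    refine (hcont.tendsto' 0 _ ?_).mono_left nhdsWithin_le_nhds
    simp only [add_zero, sub_zero]; ring
  refine ⟨1, -Real.sinh 2 / Real.cosh 1 ^ 4,
    div_ne_zero (neg_ne_zero.2 (Real.sinh_pos_iff.2 two_pos).ne')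
      (pow_pos (Real.cosh_pos 1) 4).ne', ?_⟩
  refine (mul_one (-Real.sinh 2 / Real.cosh 1 ^ 4) ▸ one_pow (M := ℝ) 2 ▸
    hcoeff.mul (hsinh.pow 2)).congr' ?_
  filter_upwards [self_mem_nhdsWithin] with t (ht : t ≠ 0)
  have hcosh (x : ℝ) : Real.cosh x ≠ 0 := (Real.cosh_pos x).ne'
  have hsum : Real.tanh (1 + t) + Real.tanh (1 - t)
      = Real.sinh 2 / (Real.cosh (1 + t) * Real.cosh (1 - t)) := by
    rw [Real.tanh_eq_sinh_div_cosh, Real.tanh_eq_sinh_div_cosh,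
      div_add_div _ _ (hcosh _) (hcosh _), ← Real.sinh_add]
    ring_nf
  have hprod : Real.cosh (1 + t) * Real.cosh (1 - t) = Real.cosh 1 ^ 2 + Real.sinh t ^ 2 := by
    rw [Real.cosh_add, Real.cosh_sub]
    linear_combination Real.cosh 1 ^ 2 * Real.cosh_sq t + Real.sinh t ^ 2 * Real.cosh_sq 1
  have htwo : Real.sinh 2 = 2 * Real.sinh 1 * Real.cosh 1 := by
    rw [← Real.sinh_two_mul, mul_one]
  have hne : Real.cosh 1 ^ 2 + Real.sinh t ^ 2 ≠ 0 := hprod ▸ mul_ne_zero (hcosh _) (hcosh _)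
  rw [hsum, hprod, htwo, Real.tanh_eq_sinh_div_cosh]
  have := hcosh 1
  field_simp
  ring

theorem approximable_mul (hσ : HasNonzeroCurvature σ) {n m : ℕ}
    (A B : Fin m → (Fin n → ℝ) →ᵃ[ℝ] ℝ) :
    Approximable σ n m [m * 4] (fun x i => A i x * B i x) := by
  intro R ε hε
  have hcont (A : Fin m → (Fin n → ℝ) →ᵃ[ℝ] ℝ) : Continuous fun x i => A i x :=
    continuous_pi fun i => (A i).continuous_of_finiteDimensional
  have hball := isCompact_closedBall (0 : Fin n → ℝ) R
  obtain ⟨QA, hQA⟩ := (hball.image (hcont A)).isBounded.exists_norm_le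
  obtain ⟨QB, hQB⟩ := (hball.image (hcont B)).isBounded.exists_norm_le
  obtain ⟨a, h, q, hmul⟩ := hσ.exists_approx_mul (max QA QB) hε
  let base : (Fin n → ℝ) →ᵃ[ℝ] ℝ := AffineMap.const ℝ _ a
  let inner : Fin m → Fin 4 → (Fin n → ℝ) →ᵃ[ℝ] ℝ := fun i =>
    ![base + h • (A i + B i), base - h • (A i + B i),
      base + h • (A i - B i), base - h • (A i - B i)]
  let neuron : Fin m → Fin 4 → (Fin (m * 4) → ℝ) →ₗ[ℝ] ℝ := fun i k =>
    LinearMap.proj (finProdFinEquiv (i, k))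
  refine ⟨_, ⟨AffineMap.pi fun j => inner (finProdFinEquiv.symm j).1 (finProdFinEquiv.symm j).2, _,
    ⟨AffineMap.pi fun i => (q • (neuron i 0 + neuron i 1 - neuron i 2 - neuron i 3)).toAffineMap,
      rfl⟩, rfl⟩, fun x hx => (pi_norm_le_iff_of_nonneg hε.le).2 fun i => ?_⟩
  have hx' : x ∈ Metric.closedBall 0 R := by simpa using hx
  have hA : |A i x| ≤ max QA QB :=
    (norm_le_pi_norm (fun i => A i x) i).trans ((hQA _ ⟨x, hx', rfl⟩).trans (le_max_left _ _))
  have hB : |B i x| ≤ max QA QB :=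
    (norm_le_pi_norm (fun i => B i x) i).trans ((hQB _ ⟨x, hx', rfl⟩).trans (le_max_right _ _))
  simpa [inner, neuron, base, -finProdFinEquiv_symm_apply, -smul_add] using hmul _ _ hA hB

theorem prod_range_two_mul {M : Type*} [CommMonoid M] (f : ℕ → M) (m : ℕ) :
    ∏ j ∈ Finset.range (2 * m), f j = ∏ j ∈ Finset.range m, (f (2 * j) * f (2 * j + 1)) := by
  induction m with
  | zero => simp
  | succ m ih =>
    rw [Nat.mul_succ, Finset.prod_range_succ, Finset.prod_range_succ, ih, Finset.prod_range_succ,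
      mul_assoc]

/-- The hidden widths of a network that evaluates `s` binary product trees of height `m` in
parallel; the factor `4` is the number of neurons per product. -/
def treeWidths (s : ℕ) : ℕ → List ℕ
  | 0 => [4]
  | m + 1 => (s * 2 ^ m * 4) :: treeWidths s m

theorem approximable_sum_smul (hσ : HasNonzeroCurvature σ) {n s : ℕ} (d : Fin s → ℝ)
    (l : Fin s → (Fin n → ℝ) →ᵃ[ℝ] ℝ) : Approximable σ n 1 [4] (fun x _ => ∑ i, d i * l i x) := by
  have heval (x : Fin n → ℝ) : (∑ i, d i • l i) x = ∑ i, d i * l i x := by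
    induction (Finset.univ : Finset (Fin s)) using Finset.induction_on with
    | empty => simp
    | insert i u hi ih => simp [Finset.sum_insert hi, ih]
  simpa [heval] using approximable_mul hσ (m := 1) (fun _ => ∑ i, d i • l i)
    (fun _ => AffineMap.const ℝ (Fin n → ℝ) 1)

theorem approximable_sum_prod (hσ : HasNonzeroCurvature σ) {s : ℕ} (m : ℕ) {n : ℕ} (d : Fin s → ℝ)
    (l : Fin s → ℕ → (Fin n → ℝ) →ᵃ[ℝ] ℝ) :
    Approximable σ n 1 (treeWidths s m)
      (fun x _ => ∑ i, d i * ∏ j ∈ Finset.range (2 ^ m), l i j x) := by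
  have hcont {n : ℕ} (f : (Fin n → ℝ) →ᵃ[ℝ] ℝ) : Continuous f := f.continuous_of_finiteDimensional
  induction m generalizing n with
  | zero => simpa [treeWidths] using approximable_sum_smul hσ d fun i => l i 0
  | succ m ih =>
    let idx : Fin (s * 2 ^ m) → Fin s × Fin (2 ^ m) := finProdFinEquiv.symm
    let pairs : Fin s → ℕ → (Fin (s * 2 ^ m) → ℝ) →ᵃ[ℝ] ℝ := fun i j =>
      if h : j < 2 ^ m then
        (LinearMap.proj (R := ℝ) (φ := fun _ => ℝ) (finProdFinEquiv (i, ⟨j, h⟩))).toAffineMap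
      else 0
    have hcomp := (ih pairs).comp
      (approximable_mul hσ (fun k => l (idx k).1 (2 * (idx k).2))
        (fun k => l (idx k).1 (2 * (idx k).2 + 1)))
      (continuous_pi fun _ => continuous_finsetSum _ fun i _ => continuous_const.mul
        (continuous_finsetProd _ fun j _ => hcont _))
      (continuous_pi fun k => (hcont _).mul (hcont _))
    rw [treeWidths]
    convert hcomp using 4 with x _ i
    rw [pow_succ', prod_range_two_mul]
    refine congrArg _ (Finset.prod_congr rfl fun j hj => ?_)
    simp [pairs, Finset.mem_range.1 hj, idx, -finProdFinEquiv_symm_apply]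

theorem exists_affineMap_prod_range_eq {E : Type*} [AddCommGroup E] [Module ℝ E] {N : ℕ}
    (L : List (E →ᵃ[ℝ] ℝ)) (hL : L.length ≤ N) :
    ∃ l : ℕ → E →ᵃ[ℝ] ℝ, ∀ x, ∏ j ∈ Finset.range N, l j x = (L.map fun g => g x).prod := by
  induction L generalizing N with
  | nil => exact ⟨fun _ => AffineMap.const ℝ E 1, by simp⟩
  | cons g L ih =>
    obtain ⟨N, rfl⟩ := Nat.exists_eq_succ_of_ne_zero (Nat.ne_zero_of_lt hL)
    obtain ⟨l, hl⟩ := ih (Nat.le_of_succ_le_succ hL)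
    exact ⟨fun j => j.casesOn g l, fun x => by
      simp [Finset.prod_range_succ', ← hl, mul_comm]⟩

theorem exists_affineMap_prod_range_eq_monomial {n N : ℕ} (ν : Fin n → ℕ) (hν : ∑ i, ν i ≤ N) :
    ∃ l : ℕ → (Fin n → ℝ) →ᵃ[ℝ] ℝ, ∀ x, ∏ j ∈ Finset.range N, l j x = ∏ i, x i ^ ν i := by
  let coord : Fin n → (Fin n → ℝ) →ᵃ[ℝ] ℝ := fun i =>
    (LinearMap.proj (R := ℝ) (φ := fun _ => ℝ) i).toAffineMap
  obtain ⟨l, hl⟩ := exists_affineMap_prod_range_eq (N := N)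
    ((List.finRange n).flatMap fun i => List.replicate (ν i) (coord i))
    (by simpa [List.length_flatMap, ← Fin.sum_univ_def] using hν)
  refine ⟨l, fun x => (hl x).trans ?_⟩
  simp [List.flatMap, List.prod_flatten, Function.comp_def, coord, Fin.prod_univ_def]

theorem exists_approx_sum_monomials (hσ : HasNonzeroCurvature σ) {ι : Type*} {n s m : ℕ}
    (Λ : Finset ι) (hΛ : Λ.card ≤ s) (e : ι → Fin n → ℕ) (hdeg : ∀ ν ∈ Λ, ∑ i, e ν i ≤ 2 ^ m)
    (d : ι → ℝ) (R : ℝ) {ε : ℝ} (hε : 0 < ε) :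
    ∃ Φ ∈ realizations σ 1 n (treeWidths s m), ∀ x, ‖x‖ ≤ R →
      |Φ x 0 - ∑ ν ∈ Λ, d ν * ∏ i, x i ^ e ν i| ≤ ε := by
  choose! l hl using fun ν hν => exists_affineMap_prod_range_eq_monomial (e ν) (hdeg ν hν)
  obtain ⟨φ⟩ : Nonempty (Λ ↪ Fin s) :=
    Function.Embedding.nonempty_of_card_le (by simpa using hΛ)
  obtain ⟨Φ, hΦ, happrox⟩ := approximable_sum_prod hσ m
    (Function.extend φ (fun ν => d ν) 0) (Function.extend φ (fun ν => l ν) 0) R ε hε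
  refine ⟨Φ, hΦ, fun x hx => ?_⟩
  have hsum : ∑ ν ∈ Λ, d ν * ∏ i, x i ^ e ν i = ∑ k, Function.extend φ (fun ν => d ν) 0 k *
      ∏ j ∈ Finset.range (2 ^ m), Function.extend φ (fun ν : Λ => l ν) 0 k j x := by
    rw [← Finset.sum_coe_sort]
    refine Fintype.sum_of_injective φ φ.injective _ _ (fun k hk => ?_) fun ν => ?_
    · rw [Function.extend_apply' _ _ _ (by simpa using hk), Pi.zero_apply, zero_mul]
    · rw [φ.injective.extend_apply, φ.injective.extend_apply, hl ν ν.2]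
  rw [hsum]
  exact (norm_le_pi_norm (Φ x - _) 0).trans (happrox x hx)

theorem treeWidths_ne_nil (s m : ℕ) : treeWidths s m ≠ [] := by
  cases m <;> simp [treeWidths]

theorem length_treeWidths (s m : ℕ) : (treeWidths s m).length = m + 1 := by
  induction m with
  | zero => rfl
  | succ m ih => simp [treeWidths, ih]

theorem pos_of_mem_treeWidths {s : ℕ} (hs : s ≠ 0) (m : ℕ) : ∀ N ∈ treeWidths s m, 0 < N := by
  induction m with
  | zero => simp [treeWidths]
  | succ m ih => exact List.forall_mem_cons.2 ⟨by positivity, ih⟩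

theorem foldr_max_treeWidths_le {s W : ℕ} (hW : 4 ≤ W) (m : ℕ) (h : s * 2 ^ m * 4 ≤ 2 * W) :
    (treeWidths s m).foldr max 0 ≤ W := by
  induction m with
  | zero => simpa [treeWidths]
  | succ m ih =>
    rw [pow_succ] at h
    simp only [treeWidths, List.foldr_cons, max_le_iff]
    exact ⟨by linarith, ih (by nlinarith)⟩

theorem two_pow_clog_le {s : ℕ} (hs : s ≠ 0) : 2 ^ Nat.clog 2 s ≤ 2 * s := by
  rcases Nat.lt_or_ge 1 s with h | h
  · have hlt := Nat.pow_pred_clog_lt_self one_lt_two h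
    obtain ⟨k, hk⟩ := Nat.exists_eq_succ_of_ne_zero (Nat.clog_pos one_lt_two h).ne'
    rw [hk, Nat.pred_succ] at hlt
    rw [hk, pow_succ]
    omega
  · obtain rfl : s = 1 := by omega
    simp

/-- The architecture of a network that evaluates `s` products of up to `s` factors. -/
def treeArchitecture (s : ℕ) (hs : s ≠ 0) : Architecture where
  hidden := treeWidths s (Nat.clog 2 s)
  ne_nil := treeWidths_ne_nil _ _
  pos := pos_of_mem_treeWidths hs _

theorem width_treeArchitecture_le {s : ℕ} (hs : s ≠ 0) :
    ((treeArchitecture s hs).width : ℝ) ≤ 4 * (s : ℝ) ^ 2 := by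
  have hone : 1 ≤ s ^ 2 := Nat.one_le_pow _ _ (Nat.pos_of_ne_zero hs)
  have hpow := two_pow_clog_le hs
  have : (treeArchitecture s hs).width ≤ 4 * s ^ 2 :=
    foldr_max_treeWidths_le (by linarith) _ (by nlinarith)
  exact_mod_cast this

theorem depth_treeArchitecture_le {s : ℕ} (hs : s ≠ 0) :
    ((treeArchitecture s hs).depth : ℝ) ≤ 2 / Real.log 2 * Real.log s := by
  have hlog2 := Real.log_pos one_lt_two
  rw [Architecture.depth, treeArchitecture, length_treeWidths, Nat.add_sub_cancel,
    div_mul_eq_mul_div, le_div_iff₀ hlog2]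
  rcases (Nat.one_le_iff_ne_zero.2 hs).eq_or_lt with rfl | h
  · simp
  calc (Nat.clog 2 s : ℝ) * Real.log 2 = Real.log (2 ^ Nat.clog 2 s) := (Real.log_pow _ _).symm
    _ ≤ Real.log (2 * s) :=
      Real.log_le_log (by positivity) (by exact_mod_cast two_pow_clog_le hs)
    _ = Real.log 2 + Real.log s := Real.log_mul two_ne_zero (by exact_mod_cast hs)
    _ ≤ 2 * Real.log s := by
      linarith [Real.log_le_log two_pos (by exact_mod_cast h : (2 : ℝ) ≤ s)]

end Networks

/-! ### Best `s`-term approximation of `ℓ^p` sequences -/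

section Stechkin

variable {α : Type*} {w : α → ℝ} {p ε : ℝ}

theorem finite_setOf_le_of_summable_rpow (hp : 0 < p) (hsum : Summable fun a => w a ^ p)
    (hε : 0 < ε) : {a | ε ≤ w a}.Finite := by
  have hlt : ∀ᶠ a in Filter.cofinite, w a ^ p < ε ^ p :=
    hsum.tendsto_cofinite_zero.eventually_lt_const (Real.rpow_pos_of_pos hε p)
  exact Set.Finite.subset hlt fun a (ha : ε ≤ w a) =>
    (Real.rpow_le_rpow hε.le ha hp.le).not_gt

theorem card_mul_rpow_le_tsum (hw : ∀ a, 0 ≤ w a) (hp : 0 ≤ p) (hsum : Summable fun a => w a ^ p)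
    (hε : 0 ≤ ε) {u : Finset α} (hu : ∀ a ∈ u, ε ≤ w a) : u.card * ε ^ p ≤ ∑' a, w a ^ p :=
  calc u.card * ε ^ p ≤ ∑ a ∈ u, w a ^ p := by
        rw [← nsmul_eq_mul]
        exact Finset.card_nsmul_le_sum _ _ _ fun a ha => Real.rpow_le_rpow hε (hu a ha) hp
    _ ≤ _ := hsum.sum_le_tsum u fun a _ => Real.rpow_nonneg (hw a) p

theorem sum_sq_le_rpow_mul_tsum (hw : ∀ a, 0 ≤ w a) (hp : 0 ≤ p) (hp2 : p ≤ 2)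
    (hsum : Summable fun a => w a ^ p) (hε : 0 ≤ ε) {u : Finset α} (hu : ∀ a ∈ u, w a ≤ ε) :
    ∑ a ∈ u, w a ^ 2 ≤ ε ^ (2 - p) * ∑' a, w a ^ p :=
  calc ∑ a ∈ u, w a ^ 2 = ∑ a ∈ u, w a ^ (2 - p) * w a ^ p :=
        Finset.sum_congr rfl fun a _ => by
          rw [← Real.rpow_add_of_nonneg (hw a) (sub_nonneg.2 hp2) hp, sub_add_cancel,
            Real.rpow_two]
    _ ≤ ∑ a ∈ u, ε ^ (2 - p) * w a ^ p := Finset.sum_le_sum fun a ha =>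
        mul_le_mul_of_nonneg_right (Real.rpow_le_rpow (hw a) (hu a ha) (sub_nonneg.2 hp2))
          (Real.rpow_nonneg (hw a) p)
    _ = ε ^ (2 - p) * ∑ a ∈ u, w a ^ p := (Finset.mul_sum _ _ _).symm
    _ ≤ _ := mul_le_mul_of_nonneg_left
        (hsum.sum_le_tsum u fun a _ => Real.rpow_nonneg (hw a) p) (Real.rpow_nonneg hε _)

theorem exists_superlevel_finset (hw : ∀ a, 0 ≤ w a) (hp : 0 < p) (hp2 : p ≤ 2)
    (hsum : Summable fun a => w a ^ p) :
    ∃ C : ℝ, 0 ≤ C ∧ ∀ s : ℕ, s ≠ 0 → ∃ Λ : Finset α, Λ.card ≤ s ∧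
      (∀ a ∈ Λ, ∀ a', w a ≤ w a' → a' ∈ Λ) ∧
      ∀ u : Finset α, Disjoint u Λ →
        ∑ a ∈ u, w a ^ 2 ≤ (C * (s : ℝ) ^ (1 / 2 - 1 / p)) ^ 2 := by
  set T := ∑' a, w a ^ p + 1
  have h0 : 0 ≤ ∑' a, w a ^ p := tsum_nonneg fun a => Real.rpow_nonneg (hw a) p
  have hT : 0 < T := by positivity
  have hsum_le : ∑' a, w a ^ p ≤ T := (lt_add_one _).le
  refine ⟨T ^ (1 / p), by positivity, fun s hs => ?_⟩
  have hs0 : (0 : ℝ) < s := by positivity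
  set ε := (T / s) ^ (1 / p) with hεT
  have hε : 0 < ε := by positivity
  have hεp : ε ^ p = T / s := by
    rw [← Real.rpow_mul (by positivity), one_div_mul_cancel hp.ne', Real.rpow_one]
  have hfin := finite_setOf_le_of_summable_rpow hp hsum hε
  refine ⟨hfin.toFinset, ?_, fun a ha a' haa' => ?_, fun u hu => ?_⟩
  · have hcard := (card_mul_rpow_le_tsum hw hp.le hsum hε.le
      fun a ha => hfin.mem_toFinset.1 ha).trans hsum_le
    rw [hεp, mul_div_assoc', div_le_iff₀ hs0, mul_comm] at hcard
    exact_mod_cast le_of_mul_le_mul_left hcard hT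
  · exact hfin.mem_toFinset.2 ((hfin.mem_toFinset.1 ha).trans haa')
  · have hsmall : ∀ a ∈ u, w a ≤ ε := fun a ha =>
      (not_le.1 fun h => Finset.disjoint_left.1 hu ha (hfin.mem_toFinset.2 h)).le
    calc ∑ a ∈ u, w a ^ 2 ≤ ε ^ (2 - p) * T :=
          (sum_sq_le_rpow_mul_tsum hw hp.le hp2 hsum hε.le hsmall).trans
            (mul_le_mul_of_nonneg_left hsum_le (by positivity))
      _ = (T ^ (1 / p) * (s : ℝ) ^ (1 / 2 - 1 / p)) ^ 2 := by
        have hε2 : ε ^ (2 : ℝ) = (T ^ (1 / p)) ^ 2 / ((s : ℝ) ^ (1 / p)) ^ 2 := by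
          rw [Real.rpow_two, hεT, Real.div_rpow hT.le hs0.le, div_pow]
        have hs2 : ((s : ℝ) ^ (1 / 2 : ℝ)) ^ 2 = s := by
          rw [← Real.sqrt_eq_rpow, Real.sq_sqrt hs0.le]
        rw [Real.rpow_sub hε, hεp, hε2, Real.rpow_sub hs0, mul_pow, div_pow, hs2]
        field_simp

end Stechkin

/-! ### Summability over multi-indices -/

section MultiIndices

open scoped Nat

variable {ι : Type*}

/-- The general term `|ν|! / ν! * γ ^ ν` of a multinomial series. -/
noncomputable def multinomialTerm (γ : ι → ℝ) (ν : ι →₀ ℕ) : ℝ :=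
  (ν.degree ! : ℝ) * ν.prod fun j n => γ j ^ n / n !

theorem multinomialTerm_nonneg {γ : ι → ℝ} (hγ : ∀ j, 0 ≤ γ j) (ν : ι →₀ ℕ) :
    0 ≤ multinomialTerm γ ν :=
  mul_nonneg (by positivity) (Finset.prod_nonneg fun j _ => by positivity [hγ j])

theorem multinomialTerm_congr {γ γ' : ι → ℝ} {ν : ι →₀ ℕ} (h : ∀ j ∈ ν.support, γ j = γ' j) :
    multinomialTerm γ ν = multinomialTerm γ' ν :=
  congrArg _ (Finset.prod_congr rfl fun j hj => by simp only [h j hj])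

theorem degree_eq_sum_of_support_subset {ν : ι →₀ ℕ} {S : Finset ι} (h : ν.support ⊆ S) :
    ν.degree = ∑ j ∈ S, ν j :=
  Finset.sum_subset h fun _ _ => Finsupp.notMem_support_iff.1

theorem sum_le_degree (ν : ι →₀ ℕ) (T : Finset ι) : ∑ j ∈ T, ν j ≤ ν.degree := by
  classical
  rw [degree_eq_sum_of_support_subset (S := T ∪ ν.support) Finset.subset_union_right]
  exact Finset.sum_le_sum_of_subset Finset.subset_union_left

theorem multinomialTerm_eq_multinomial_mul {γ : ι → ℝ} {ν : ι →₀ ℕ} {S : Finset ι}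
    (h : ν.support ⊆ S) :
    multinomialTerm γ ν = (Nat.multinomial S ν : ℝ) * ∏ j ∈ S, γ j ^ ν j := by
  have hspec : (∏ j ∈ S, ((ν j)! : ℝ)) * (Nat.multinomial S ν : ℝ) = (ν.degree ! : ℝ) := by
    rw [degree_eq_sum_of_support_subset h, ← Nat.multinomial_spec S ν]
    push_cast
    rfl
  have hne : (∏ j ∈ S, ((ν j)! : ℝ)) ≠ 0 := Finset.prod_ne_zero_iff.2 fun j _ => by positivity
  rw [multinomialTerm, Finsupp.prod_of_support_subset _ h _ (by simp), ← hspec,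
    Finset.prod_div_distrib]
  field_simp

theorem sum_multinomialTerm_le_pow {γ : ι → ℝ} (hγ : ∀ j, 0 ≤ γ j) {S : Finset ι} {n : ℕ}
    {u : Finset (ι →₀ ℕ)} (hS : ∀ ν ∈ u, ν.support ⊆ S) (hn : ∀ ν ∈ u, ν.degree = n) :
    ∑ ν ∈ u, multinomialTerm γ ν ≤ (∑ j ∈ S, γ j) ^ n := by
  classical
  have hsub : u.image (fun ν : ι →₀ ℕ => ⇑ν) ⊆ S.piAntidiag n := by
    refine Finset.image_subset_iff.2 fun ν hν => Finset.mem_piAntidiag.2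
      ⟨(degree_eq_sum_of_support_subset (hS ν hν)).symm.trans (hn ν hν), fun j hj => ?_⟩
    exact hS ν hν (Finsupp.mem_support_iff.2 hj)
  calc ∑ ν ∈ u, multinomialTerm γ ν
      = ∑ ν ∈ u, (Nat.multinomial S ν : ℝ) * ∏ j ∈ S, γ j ^ ν j :=
        Finset.sum_congr rfl fun ν hν => multinomialTerm_eq_multinomial_mul (hS ν hν)
    _ = ∑ k ∈ u.image (fun ν : ι →₀ ℕ => ⇑ν), (Nat.multinomial S k : ℝ) * ∏ j ∈ S, γ j ^ k j := by
        rw [Finset.sum_image DFunLike.coe_injective.injOn]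
    _ ≤ ∑ k ∈ S.piAntidiag n, (Nat.multinomial S k : ℝ) * ∏ j ∈ S, γ j ^ k j :=
        Finset.sum_le_sum_of_subset_of_nonneg hsub fun k _ _ =>
          mul_nonneg (by positivity) (Finset.prod_nonneg fun j _ => by positivity [hγ j])
    _ = (∑ j ∈ S, γ j) ^ n := (Finset.sum_pow_eq_sum_piAntidiag S γ n).symm

theorem summable_multinomialTerm {γ : ι → ℝ} (hγ : ∀ j, 0 ≤ γ j) {q : ℝ} (hq : q < 1)
    (h : ∀ S : Finset ι, ∑ j ∈ S, γ j ≤ q) : Summable (multinomialTerm γ) := by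
  classical
  have hq0 : 0 ≤ q := by simpa using h ∅
  refine summable_of_sum_le (c := ∑' n : ℕ, q ^ n) (multinomialTerm_nonneg hγ) fun u => ?_
  set S := u.biUnion Finsupp.support
  rw [← Finset.sum_fiberwise_of_maps_to (t := u.image Finsupp.degree) (g := Finsupp.degree)
    fun ν hν => Finset.mem_image_of_mem _ hν]
  calc ∑ n ∈ u.image Finsupp.degree, ∑ ν ∈ u with ν.degree = n, multinomialTerm γ ν
      ≤ ∑ n ∈ u.image Finsupp.degree, (∑ j ∈ S, γ j) ^ n :=
        Finset.sum_le_sum fun n _ => sum_multinomialTerm_le_pow hγ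
          (fun ν hν => Finset.subset_biUnion_of_mem Finsupp.support (Finset.mem_filter.1 hν).1)
          fun ν hν => (Finset.mem_filter.1 hν).2
    _ ≤ ∑ n ∈ u.image Finsupp.degree, q ^ n := Finset.sum_le_sum fun n _ =>
        pow_le_pow_left₀ (Finset.sum_nonneg fun j _ => hγ j) (h S) n
    _ ≤ ∑' n : ℕ, q ^ n :=
        (summable_geometric_of_lt_one hq0 hq).sum_le_tsum _ fun n _ => by positivity

theorem multinomialTerm_rpow_le {γ : ι → ℝ} (hγ : ∀ j, 0 ≤ γ j) {p : ℝ} (hp1 : p ≤ 1)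
    (ν : ι →₀ ℕ) : multinomialTerm γ ν ^ p ≤ multinomialTerm (fun j => γ j ^ p) ν := by
  have hpow (j : ι) : 0 ≤ γ j ^ ν j := pow_nonneg (hγ j) _
  have hone : (1 : ℝ) ≤ Nat.multinomial ν.support ν := by
    exact_mod_cast Nat.multinomial_pos _ _
  rw [multinomialTerm_eq_multinomial_mul subset_rfl, multinomialTerm_eq_multinomial_mul subset_rfl,
    Real.mul_rpow (by positivity) (Finset.prod_nonneg fun j _ => hpow j),
    ← Real.finsetProd_rpow _ _ fun j _ => hpow j]
  simp_rw [← Real.rpow_pow_comm (hγ _)]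
  refine mul_le_mul_of_nonneg_right (Real.rpow_le_self_of_one_le hone hp1)
    (Finset.prod_nonneg fun j _ => by positivity [Real.rpow_nonneg (hγ j) p])

theorem summable_prod_pow_mul_filter [DecidableEq ι] {q : ℝ} (hq0 : 0 ≤ q) (hq : q < 1)
    {H : (ι →₀ ℕ) → ℝ} (hH0 : ∀ ν, 0 ≤ H ν) (hH : Summable H) (S : Finset ι) :
    Summable fun ν : ι →₀ ℕ => (∏ j ∈ S, q ^ ν j) * H (ν.filter (· ∉ S)) := by
  induction S using Finset.induction_on with
  | empty =>
    have hfilter (ν : ι →₀ ℕ) : ν.filter (· ∉ (∅ : Finset ι)) = ν :=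
      (Finsupp.filter_eq_self_iff _ _).2 fun j _ => Finset.notMem_empty j
    simpa only [Finset.prod_empty, one_mul, hfilter] using hH
  | insert i S hi ih =>
    have hprod := (summable_geometric_of_lt_one hq0 hq).mul_of_nonneg ih
      (fun n => pow_nonneg hq0 n)
      (fun ν => mul_nonneg (Finset.prod_nonneg fun j _ => pow_nonneg hq0 _) (hH0 _))
    have hinj : Function.Injective fun ν : ι →₀ ℕ => (ν i, ν.erase i) := fun ν μ h => by
      rw [← Finsupp.single_add_erase i ν, ← Finsupp.single_add_erase i μ]
      simp only [Prod.mk.injEq] at h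
      rw [h.1, h.2]
    refine (hprod.comp_injective hinj).congr fun ν => ?_
    have hfilter : (ν.erase i).filter (· ∉ S) = ν.filter (· ∉ insert i S) := by
      ext j
      by_cases hj : j = i <;> simp [Finsupp.filter_apply, hj]
    have hhead : ∏ j ∈ S, q ^ (ν.erase i) j = ∏ j ∈ S, q ^ ν j :=
      Finset.prod_congr rfl fun j hj => by
        rw [Finsupp.erase_ne (ne_of_mem_of_not_mem hj hi)]
    simp only [Function.comp_apply]
    rw [hfilter, hhead, Finset.prod_insert hi, mul_assoc]

end MultiIndices

/-! ### The decay of the coefficients -/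

section Weight

open scoped Nat

variable {ι : Type*}

theorem joukowsky_sub_one_nonneg {r : ℝ} (hr : 0 < r) : 0 ≤ (r + r⁻¹) / 2 - 1 := by
  have : (r + r⁻¹) / 2 - 1 = (r - 1) ^ 2 / (2 * r) := by field_simp; ring
  rw [this]
  positivity

theorem joukowsky_sub_one_le {r : ℝ} (hr : 1 ≤ r) : (r + r⁻¹) / 2 - 1 ≤ (r - 1) / 2 := by
  linarith [inv_le_one_of_one_le₀ hr]

/-- The bound, for functions holomorphic and bounded by one on the Bernstein ellipse with
parameter `r ≥ 1`, on the coefficient of degree `n` with respect to orthonormal polynomials on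
`[-1, 1]`. The ellipse with parameter one is a segment and gives no decay. -/
noncomputable def coeffDecay (r : ℝ) (n : ℕ) : ℝ :=
  if 1 < r then min 1 (2 / (1 - r⁻¹) * r⁻¹ ^ n) else 1

/-- The parameters of the polyellipses that are admissible for `b`; the partial sums replace the
series in the definition of the region, so that no summability has to be carried along. -/
def feasible (b : ι → ℝ) : Set (ι → ℝ) :=
  {r | (∀ j, 1 ≤ r j) ∧ ∀ S : Finset ι, ∑ j ∈ S, ((r j + (r j)⁻¹) / 2 - 1) * b j ≤ 1}

/-- The best bound on the coefficient with multi-index `ν` that the admissible polyellipses give. -/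
noncomputable def coeffWeight (b : ι → ℝ) (ν : ι →₀ ℕ) : ℝ :=
  ⨅ r : feasible b, ν.prod fun j n => coeffDecay (r.1 j) n

theorem two_div_one_sub_inv_nonneg {r : ℝ} (hr : 1 < r) : 0 ≤ 2 / (1 - r⁻¹) :=
  div_nonneg two_pos.le (sub_nonneg.2 (inv_lt_one_of_one_lt₀ hr).le)

theorem coeffDecay_le {r : ℝ} (hr : 1 < r) (n : ℕ) :
    coeffDecay r n ≤ 2 / (1 - r⁻¹) * r⁻¹ ^ n := by
  rw [coeffDecay, if_pos hr]
  exact min_le_right _ _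

theorem coeffDecay_nonneg (r : ℝ) (n : ℕ) : 0 ≤ coeffDecay r n := by
  unfold coeffDecay
  split_ifs with hr
  · exact le_min zero_le_one (by positivity [two_div_one_sub_inv_nonneg hr])
  · exact zero_le_one

theorem coeffDecay_zero (r : ℝ) : coeffDecay r 0 = 1 := by
  unfold coeffDecay
  split_ifs with hr
  · have hr1 := inv_lt_one_of_one_lt₀ hr
    have hr0 : 0 < r⁻¹ := by positivity
    rw [pow_zero, mul_one, min_eq_left]
    rw [one_le_div (by linarith)]
    linarith
  · rfl

theorem coeffDecay_antitone (r : ℝ) : Antitone (coeffDecay r) := fun m n hmn => by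
  unfold coeffDecay
  split_ifs with hr
  · exact min_le_min_left _ (mul_le_mul_of_nonneg_left
      (pow_le_pow_of_le_one (by positivity) (inv_lt_one_of_one_lt₀ hr).le hmn)
      (two_div_one_sub_inv_nonneg hr))
  · rfl

theorem coeffDecay_le_pow {r : ℝ} (hr : 8 ≤ r) {n : ℕ} (hn : n ≠ 0) :
    coeffDecay r n ≤ (4 / r) ^ n := by
  have hr8 : r⁻¹ ≤ 1 / 8 := by rw [← one_div]; exact one_div_le_one_div_of_le (by norm_num) hr
  have hfour : (4 : ℝ) ≤ 4 ^ n := le_self_pow₀ (by norm_num) hn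
  calc coeffDecay r n ≤ 2 / (1 - r⁻¹) * r⁻¹ ^ n := coeffDecay_le (by linarith) n
    _ ≤ 4 ^ n * r⁻¹ ^ n := by
      gcongr
      refine le_trans ?_ hfour
      rw [div_le_iff₀ (by linarith)]
      linarith
    _ = (4 / r) ^ n := by rw [div_eq_mul_inv, mul_pow]

theorem one_mem_feasible (b : ι → ℝ) : (fun _ => 1) ∈ feasible b :=
  ⟨fun _ => le_rfl, fun _ => by simp⟩

theorem prod_coeffDecay_nonneg (r : ι → ℝ) (ν : ι →₀ ℕ) :
    0 ≤ ν.prod fun j n => coeffDecay (r j) n :=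
  Finset.prod_nonneg fun j _ => coeffDecay_nonneg (r j) _

theorem coeffWeight_nonneg (b : ι → ℝ) (ν : ι →₀ ℕ) : 0 ≤ coeffWeight b ν :=
  Real.iInf_nonneg fun r => prod_coeffDecay_nonneg r.1 ν

theorem coeffWeight_le {b r : ι → ℝ} (hr : r ∈ feasible b) (ν : ι →₀ ℕ) :
    coeffWeight b ν ≤ ν.prod fun j n => coeffDecay (r j) n :=
  ciInf_le (f := fun r : feasible b => ν.prod fun j n => coeffDecay (r.1 j) n)
    ⟨0, Set.forall_mem_range.2 fun r => prod_coeffDecay_nonneg r.1 ν⟩ ⟨r, hr⟩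

theorem le_coeffWeight {b : ι → ℝ} {ν : ι →₀ ℕ} {c : ℝ}
    (h : ∀ r ∈ feasible b, c ≤ ν.prod fun j n => coeffDecay (r j) n) : c ≤ coeffWeight b ν :=
  have : Nonempty (feasible b) := ⟨⟨_, one_mem_feasible b⟩⟩
  le_ciInf fun r => h r r.2

theorem coeffWeight_antitone (b : ι → ℝ) : Antitone (coeffWeight b) := fun μ ν hμν => by
  refine le_coeffWeight fun r hr => (coeffWeight_le hr ν).trans ?_
  rw [Finsupp.prod_of_support_subset μ (Finsupp.support_mono hμν) _
    fun j _ => coeffDecay_zero (r j)]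
  exact Finset.prod_le_prod (fun j _ => coeffDecay_nonneg _ _)
    fun j _ => coeffDecay_antitone _ (hμν j)

theorem coeffWeight_single_le {b : ι → ℝ} {i j : ι} (hij : b j ≤ b i) (n : ℕ) :
    coeffWeight b (Finsupp.single j n) ≤ coeffWeight b (Finsupp.single i n) := by
  classical
  refine le_coeffWeight fun r hr => ?_
  have hcost : ((r i + (r i)⁻¹) / 2 - 1) * b j ≤ 1 :=
    (mul_le_mul_of_nonneg_left hij (joukowsky_sub_one_nonneg (one_pos.trans_le (hr.1 i)))).trans
      (by simpa only [Finset.sum_singleton] using hr.2 {i})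
  have hfeas : Function.update (fun _ => (1 : ℝ)) j (r i) ∈ feasible b := by
    refine ⟨fun k => ?_, fun S => ?_⟩
    · rw [Function.update_apply]
      split_ifs
      exacts [hr.1 i, le_rfl]
    · rw [Finset.sum_congr rfl (g := fun k => if k = j then ((r i + (r i)⁻¹) / 2 - 1) * b j else 0)
        fun k _ => by by_cases hk : k = j <;> simp [hk], Finset.sum_ite_eq']
      split_ifs
      exacts [hcost, zero_le_one]
  simpa [Finsupp.prod_single_index, coeffDecay_zero] using
    coeffWeight_le hfeas (Finsupp.single j n)

theorem pow_self_le_exp_mul_factorial (n : ℕ) : (n : ℝ) ^ n ≤ Real.exp 1 ^ n * n ! := by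
  have := Real.pow_div_factorial_le_exp (x := n) (by positivity) n
  rw [div_le_iff₀ (by positivity)] at this
  rwa [← Real.exp_nat_mul, mul_one]

theorem prod_degree_mul_pow_div_factorial_le {t : ι → ℝ} (ht : ∀ j, 0 ≤ t j) (ν : ι →₀ ℕ) :
    (ν.prod fun j k => (ν.degree * t j) ^ k / k !) ≤
      multinomialTerm (fun j => Real.exp 1 * t j) ν := by
  have hpow (x : ℝ) : (ν.prod fun j k => (x * t j) ^ k / k !) =
      x ^ ν.degree * ν.prod fun j k => t j ^ k / k ! := by
    simp_rw [mul_pow, mul_div_assoc, Finsupp.prod_mul]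
    rw [Finsupp.prod, Finset.prod_pow_eq_pow_sum, Finsupp.degree_apply]
  rw [multinomialTerm, hpow, hpow, ← mul_assoc, mul_comm (ν.degree ! : ℝ)]
  exact mul_le_mul_of_nonneg_right (pow_self_le_exp_mul_factorial _)
    (Finset.prod_nonneg fun j _ => by positivity [ht j])

theorem coeffDecay_eight_add_le {k n : ℕ} (hk : k ≠ 0) (hn : n ≠ 0) {t : ℝ} (ht : 0 < t) :
    coeffDecay (8 + k / (2 * n * t)) k ≤ (n * (8 * t)) ^ k / k ! := by
  have hfact : (k ! : ℝ) ≤ (k : ℝ) ^ k := by exact_mod_cast Nat.factorial_le_pow k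
  have hr : 8 ≤ 8 + k / (2 * n * t) := le_add_of_nonneg_right (by positivity)
  calc _ ≤ (4 / (8 + k / (2 * n * t))) ^ k := coeffDecay_le_pow hr hk
    _ ≤ (n * (8 * t) / k) ^ k := by
      refine pow_le_pow_left₀ (by positivity) ?_ k
      calc 4 / (8 + k / (2 * n * t)) ≤ 4 / (k / (2 * n * t)) := by gcongr; linarith
        _ = n * (8 * t) / k := by field_simp; norm_num
    _ ≤ _ := by rw [div_pow]; gcongr

section Envelope

variable [DecidableEq ι] {b : ι → ℝ} {κ : ℝ} {S : Finset ι}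

/-- The parameter `κ` in the variables of `S` and, in the remaining ones, parameters adapted to
the exponents of `ν`: they nearly minimize `∏ j, (r j)⁻¹ ^ ν j` under a budget for
`∑ j, r j * b j`. -/
noncomputable def adaptedParameter (b : ι → ℝ) (κ : ℝ) (S : Finset ι) (ν : ι →₀ ℕ) (j : ι) : ℝ :=
  if j ∈ S then κ else 8 + ν j / (2 * (ν.filter (· ∉ S)).degree * b j)

theorem one_le_adaptedParameter (hb : ∀ j, 0 < b j) (hκ : 1 ≤ κ) (ν : ι →₀ ℕ) (j : ι) :
    1 ≤ adaptedParameter b κ S ν j := by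
  unfold adaptedParameter
  split_ifs
  · exact hκ
  · have : 0 ≤ (ν j : ℝ) / (2 * (ν.filter (· ∉ S)).degree * b j) := by positivity [hb j]
    linarith

theorem sum_tail_cost_le (hb : ∀ j, 0 < b j) {T : Finset ι} (hT : Disjoint T S)
    (htail : ∑ j ∈ T, b j ≤ 1 / 16) (ν : ι →₀ ℕ) :
    ∑ j ∈ T, (adaptedParameter b κ S ν j - 1) / 2 * b j ≤ 1 / 2 := by
  set F := ν.filter (· ∉ S)
  have hterm : ∀ j ∈ T, (adaptedParameter b κ S ν j - 1) / 2 * b j =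
      7 / 2 * b j + F j / (4 * F.degree) := fun j hj => by
    have hjS := Finset.disjoint_left.1 hT hj
    have hbj := (hb j).ne'
    rw [adaptedParameter, if_neg hjS, Finsupp.filter_apply_pos (· ∉ S) ν hjS]
    field_simp
    ring
  have hdeg : (∑ j ∈ T, (F j : ℝ)) / (4 * F.degree) ≤ 1 / 4 := by
    have : (∑ j ∈ T, (F j : ℝ)) ≤ F.degree := by exact_mod_cast sum_le_degree F T
    rw [mul_comm, ← div_div]
    linarith [div_le_one_of_le₀ this (by positivity)]
  rw [Finset.sum_congr rfl hterm, Finset.sum_add_distrib, ← Finset.mul_sum, ← Finset.sum_div]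
  linarith

theorem adaptedParameter_mem_feasible (hb : ∀ j, 0 < b j) (hκ : 1 ≤ κ)
    (hS : (κ - 1) * ∑ j ∈ S, b j ≤ 1)
    (htail : ∀ T : Finset ι, Disjoint T S → ∑ j ∈ T, b j ≤ 1 / 16) (ν : ι →₀ ℕ) :
    adaptedParameter b κ S ν ∈ feasible b := by
  have hone := one_le_adaptedParameter (S := S) hb hκ ν
  refine ⟨hone, fun T => ?_⟩
  have hin : ∑ j ∈ T with j ∈ S, (adaptedParameter b κ S ν j - 1) / 2 * b j ≤ 1 / 2 :=
    calc _ = (κ - 1) / 2 * ∑ j ∈ T with j ∈ S, b j := by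
          rw [Finset.mul_sum]
          refine Finset.sum_congr rfl fun j hj => ?_
          rw [adaptedParameter, if_pos (Finset.mem_filter.1 hj).2]
      _ ≤ (κ - 1) / 2 * ∑ j ∈ S, b j := by
          refine mul_le_mul_of_nonneg_left ?_ (by linarith)
          exact Finset.sum_le_sum_of_subset_of_nonneg
            (fun j hj => (Finset.mem_filter.1 hj).2) fun j _ _ => (hb j).le
      _ ≤ 1 / 2 := by linarith
  have hdisj : Disjoint (T.filter (· ∉ S)) S :=
    Finset.disjoint_left.2 fun j hj => (Finset.mem_filter.1 hj).2
  calc ∑ j ∈ T, ((adaptedParameter b κ S ν j + (adaptedParameter b κ S ν j)⁻¹) / 2 - 1) * b j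
      ≤ ∑ j ∈ T, (adaptedParameter b κ S ν j - 1) / 2 * b j := Finset.sum_le_sum fun j _ =>
        mul_le_mul_of_nonneg_right (joukowsky_sub_one_le (hone j)) (hb j).le
    _ ≤ 1 := by
        rw [← Finset.sum_filter_add_sum_filter_not T (· ∈ S)]
        linarith [sum_tail_cost_le (κ := κ) hb hdisj (htail _ hdisj) ν]

theorem prod_coeffDecay_adaptedParameter_le (hb : ∀ j, 0 < b j) (hκ : 1 < κ) (ν : ι →₀ ℕ) :
    (ν.prod fun j n => coeffDecay (adaptedParameter b κ S ν j) n) ≤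
      (∏ j ∈ S, 2 / (1 - κ⁻¹) * κ⁻¹ ^ ν j) *
        multinomialTerm (fun j => Real.exp 1 * (8 * b j)) (ν.filter (· ∉ S)) := by
  rw [← Finsupp.prod_filter_mul_prod_filter_not (· ∈ S)]
  refine mul_le_mul ?_ ?_ (prod_coeffDecay_nonneg _ _)
    (Finset.prod_nonneg fun j _ => by positivity [two_div_one_sub_inv_nonneg hκ])
  · rw [Finsupp.prod_of_support_subset (s := S) _ (fun j hj => ?_) _ fun j _ => coeffDecay_zero _]
    · refine Finset.prod_le_prod (fun j _ => coeffDecay_nonneg _ _) fun j hj => ?_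
      rw [Finsupp.filter_apply_pos (· ∈ S) ν hj, adaptedParameter, if_pos hj]
      exact coeffDecay_le hκ _
    · exact (Finset.mem_filter.1 hj).2
  · set F := ν.filter (· ∉ S) with hF
    refine le_trans (Finset.prod_le_prod (fun j _ => coeffDecay_nonneg _ _) fun j hj => ?_)
      (prod_degree_mul_pow_div_factorial_le (fun j => by positivity [hb j]) F)
    have hj0 : F j ≠ 0 := Finsupp.mem_support_iff.1 hj
    have hjS : j ∉ S := fun h => hj0 (Finsupp.filter_apply_neg (· ∉ S) ν (not_not.2 h))
    have hdeg : F.degree ≠ 0 := fun h => hj0 (by simp [(Finsupp.degree_eq_zero_iff F).1 h])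
    change coeffDecay (adaptedParameter b κ S ν j) (F j) ≤ _
    rw [adaptedParameter, if_neg hjS, ← hF, ← Finsupp.filter_apply_pos (· ∉ S) ν hjS]
    exact coeffDecay_eight_add_le hj0 hdeg (hb j)

end Envelope

theorem summable_multinomialTerm_filter_rpow [DecidableEq ι] {a : ι → ℝ} (ha : ∀ j, 0 ≤ a j)
    {p q : ℝ} (hp1 : p ≤ 1) (hq0 : 0 ≤ q) (hq1 : q < 1) {S : Finset ι}
    (hS : ∀ T : Finset ι, Disjoint T S → ∑ j ∈ T, a j ^ p ≤ 1 / 2) :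
    Summable fun ν : ι →₀ ℕ =>
      (∏ j ∈ S, q ^ ν j) * multinomialTerm a (ν.filter (· ∉ S)) ^ p := by
  set γ : ι → ℝ := fun j => if j ∉ S then a j ^ p else 0
  have hγ (j : ι) : 0 ≤ γ j := ite_nonneg (Real.rpow_nonneg (ha j) p) le_rfl
  have hsum : Summable (multinomialTerm γ) :=
    summable_multinomialTerm hγ (q := 1 / 2) (by norm_num) fun T => by
      rw [← Finset.sum_filter]
      exact hS _ (Finset.disjoint_left.2 fun j hj => (Finset.mem_filter.1 hj).2)
  refine (summable_prod_pow_mul_filter hq0 hq1 (multinomialTerm_nonneg hγ) hsum S).of_nonneg_of_le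
    (fun ν => mul_nonneg (Finset.prod_nonneg fun j _ => pow_nonneg hq0 _)
      (Real.rpow_nonneg (multinomialTerm_nonneg ha _) p)) fun ν => ?_
  refine mul_le_mul_of_nonneg_left ?_ (Finset.prod_nonneg fun j _ => pow_nonneg hq0 _)
  refine (multinomialTerm_rpow_le ha hp1 _).trans_eq (multinomialTerm_congr fun j hj => ?_)
  exact (if_pos (Finset.mem_filter.1 hj).2).symm

theorem exists_finset_sum_tail_le {b : ι → ℝ} (hb : ∀ j, 0 ≤ b j) {p : ℝ} (hp : 0 < p)
    (hp1 : p ≤ 1) (hsum : Summable fun j => b j ^ p) {c ε : ℝ} (hc : 0 ≤ c) (hε : 0 < ε)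
    (hε1 : ε ≤ 1) :
    ∃ S : Finset ι, ∀ T : Finset ι, Disjoint T S →
      ∑ j ∈ T, (c * b j) ^ p ≤ ε ∧ ∑ j ∈ T, c * b j ≤ ε := by
  have hcb (j : ι) : 0 ≤ c * b j := mul_nonneg hc (hb j)
  obtain ⟨S, hS⟩ := summable_iff_vanishing_norm.1
    (by simpa only [Real.mul_rpow hc (hb _)] using hsum.mul_left (c ^ p) :
      Summable fun j => (c * b j) ^ p) ε hε
  refine ⟨S, fun T hT => ?_⟩
  have hle : ∑ j ∈ T, (c * b j) ^ p ≤ ε := (le_abs_self _).trans (hS T hT).le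
  refine ⟨hle, (Finset.sum_le_sum fun j hj => ?_).trans hle⟩
  have hone : (c * b j) ^ p ≤ 1 := (Finset.single_le_sum (f := fun j => (c * b j) ^ p)
    (fun j _ => Real.rpow_nonneg (hcb j) p) hj).trans (hle.trans hε1)
  exact Real.self_le_rpow_of_le_one (hcb j)
    (not_lt.1 fun h => (Real.one_lt_rpow h hp).not_ge hone) hp1

theorem coeffWeight_rpow_le [DecidableEq ι] {b : ι → ℝ} (hb : ∀ j, 0 < b j) {κ : ℝ} (hκ : 1 < κ)
    {S : Finset ι} (hS : (κ - 1) * ∑ j ∈ S, b j ≤ 1)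
    (htail : ∀ T : Finset ι, Disjoint T S → ∑ j ∈ T, b j ≤ 1 / 16) {p : ℝ} (hp : 0 ≤ p)
    (ν : ι →₀ ℕ) :
    coeffWeight b ν ^ p ≤ ((2 / (1 - κ⁻¹)) ^ p) ^ S.card * ((∏ j ∈ S, (κ⁻¹ ^ p) ^ ν j) *
      multinomialTerm (fun j => Real.exp 1 * (8 * b j)) (ν.filter (· ∉ S)) ^ p) := by
  have hA := two_div_one_sub_inv_nonneg hκ
  have hκ0 : 0 ≤ κ⁻¹ := by positivity
  have hle := (coeffWeight_le (adaptedParameter_mem_feasible hb hκ.le hS htail ν) ν).trans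
    (prod_coeffDecay_adaptedParameter_le hb hκ ν)
  refine (Real.rpow_le_rpow (coeffWeight_nonneg b ν) hle hp).trans_eq ?_
  rw [Real.mul_rpow (Finset.prod_nonneg fun j _ => by positivity)
      (multinomialTerm_nonneg (fun j => by positivity [hb j]) _),
    ← Real.finsetProd_rpow _ _ fun j _ => by positivity, ← mul_assoc]
  simp_rw [Real.mul_rpow hA (pow_nonneg hκ0 _), ← Real.rpow_pow_comm hκ0,
    Finset.prod_mul_distrib, Finset.prod_const]

theorem summable_coeffWeight_rpow {b : ι → ℝ} (hb : ∀ j, 0 < b j) {p : ℝ} (hp : 0 < p)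
    (hp1 : p ≤ 1) (hsum : Summable fun j => b j ^ p) :
    Summable fun ν => coeffWeight b ν ^ p := by
  classical
  obtain ⟨S, hS⟩ := exists_finset_sum_tail_le (fun j => (hb j).le) hp hp1 hsum
    (c := Real.exp 1 * 8) (ε := 1 / 2) (by positivity) (by norm_num) (by norm_num)
  have htail (T : Finset ι) (hT : Disjoint T S) : ∑ j ∈ T, b j ≤ 1 / 16 := by
    have hle := (hS T hT).2
    rw [← Finset.mul_sum] at hle
    have hsum0 : 0 ≤ ∑ j ∈ T, b j := Finset.sum_nonneg fun j _ => (hb j).le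
    nlinarith [Real.one_le_exp zero_le_one]
  set B := ∑ j ∈ S, b j
  have hB : 0 ≤ B := Finset.sum_nonneg fun j _ => (hb j).le
  set κ := 1 + 1 / (1 + B)
  have hκ : 1 < κ := lt_add_of_pos_right _ (by positivity)
  have hκB : (κ - 1) * B ≤ 1 := by
    rw [add_sub_cancel_left, one_div_mul_eq_div]
    exact div_le_one_of_le₀ (by linarith) (by linarith)
  refine .of_nonneg_of_le (fun ν => Real.rpow_nonneg (coeffWeight_nonneg b ν) p)
    (coeffWeight_rpow_le hb hκ hκB htail hp.le) (.mul_left _ ?_)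
  refine summable_multinomialTerm_filter_rpow (fun j => by positivity [hb j]) hp1
    (by positivity) (Real.rpow_lt_one (by positivity) (inv_lt_one_of_one_lt₀ hκ) hp)
    fun T hT => ?_
  simpa only [mul_assoc] using (hS T hT).1

end Weight

/-! ### Bernstein ellipses -/

section Ellipses

open Polynomial

/-- The interior of the Bernstein ellipse with parameter `r`, described through the foci `±1`; its
openness is what the original description of the ellipse does not show. -/
def openEllipse (r : ℝ) : Set ℂ := {w | ‖w - 1‖ + ‖w + 1‖ < r + r⁻¹}

theorem mem_openEllipse {r : ℝ} {w : ℂ} : w ∈ openEllipse r ↔ ‖w - 1‖ + ‖w + 1‖ < r + r⁻¹ :=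
  Iff.rfl

theorem isOpen_openEllipse (r : ℝ) : IsOpen (openEllipse r) :=
  isOpen_lt (by fun_prop) continuous_const

theorem norm_joukowsky_sub_one_add_norm_add_one {z : ℂ} (hz : z ≠ 0) :
    ‖(z + z⁻¹) / 2 - 1‖ + ‖(z + z⁻¹) / 2 + 1‖ = ‖z‖ + ‖z‖⁻¹ := by
  have hsub : (z + z⁻¹) / 2 - 1 = (z - 1) ^ 2 / (2 * z) := by field_simp; ring
  have hadd : (z + z⁻¹) / 2 + 1 = (z + 1) ^ 2 / (2 * z) := by field_simp; ring
  have hz' : ‖z‖ ≠ 0 := norm_ne_zero_iff.2 hz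
  have hparallelogram : ‖z + 1‖ ^ 2 + ‖z - 1‖ ^ 2 = 2 * (‖z‖ ^ 2 + 1) := by
    have := parallelogram_law_with_norm ℝ z 1
    simp only [norm_one] at this
    nlinarith
  rw [hsub, hadd, norm_div, norm_div, norm_pow, norm_pow, norm_mul, ← add_div, add_comm,
    hparallelogram]
  simp only [Complex.norm_ofNat]
  field_simp

theorem exists_joukowsky (w : ℂ) : ∃ z : ℂ, 1 ≤ ‖z‖ ∧ w = (z + z⁻¹) / 2 := by
  obtain ⟨s, hs⟩ := IsAlgClosed.exists_pow_nat_eq (w ^ 2 - 1) (n := 2) two_pos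
  have hmul : (w + s) * (w - s) = 1 := by linear_combination -hs
  have h0 : w + s ≠ 0 := left_ne_zero_of_mul_eq_one hmul
  have hinv : (w + s)⁻¹ = w - s := inv_eq_of_mul_eq_one_right hmul
  by_cases h : 1 ≤ ‖w + s‖
  · exact ⟨w + s, h, by rw [hinv]; ring⟩
  · refine ⟨(w + s)⁻¹, ?_, by rw [inv_inv, hinv]; ring⟩
    rw [norm_inv]
    exact (one_le_inv₀ (norm_pos_iff.2 h0)).2 (not_le.1 h).le

theorem add_inv_lt_add_inv {x y : ℝ} (hx : 1 ≤ x) (hxy : x < y) : x + x⁻¹ < y + y⁻¹ := by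
  have : 0 < x := by linarith
  have : 0 < y := by linarith
  have hdiff : y + y⁻¹ - (x + x⁻¹) = (y - x) * (x * y - 1) / (x * y) := by field_simp; ring
  have hpos : 0 < (y - x) * (x * y - 1) / (x * y) := by
    have : 0 < x * y - 1 := by nlinarith
    have : 0 < y - x := by linarith
    positivity
  linarith

theorem openEllipse_subset_bernsteinEllipse {r : ℝ} (hr : 1 ≤ r) :
    openEllipse r ⊆ bernsteinEllipse r := by
  intro w hw
  obtain ⟨z, hz, rfl⟩ := exists_joukowsky w
  have hz0 : z ≠ 0 := norm_pos_iff.1 (by linarith)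
  have hw' : ‖z‖ + ‖z‖⁻¹ < r + r⁻¹ := by
    rw [← norm_joukowsky_sub_one_add_norm_add_one hz0]
    exact hw
  refine ⟨z, hz, ?_, rfl⟩
  by_contra! h
  linarith [add_inv_lt_add_inv hr h]

theorem joukowsky_mem_openEllipse {r : ℝ} {z : ℂ} (hr : 1 < r) (hlow : r⁻¹ < ‖z‖)
    (hhigh : ‖z‖ < r) : (z + z⁻¹) / 2 ∈ openEllipse r := by
  have hz : 0 < ‖z‖ := lt_trans (by positivity) hlow
  rw [mem_openEllipse, norm_joukowsky_sub_one_add_norm_add_one (norm_pos_iff.1 hz)]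
  rcases le_total 1 ‖z‖ with h | h
  · exact add_inv_lt_add_inv h hhigh
  · have := add_inv_lt_add_inv (x := ‖z‖⁻¹) (y := r) ((one_le_inv₀ hz).2 h)
      (inv_lt_of_inv_lt₀ (by linarith) hlow)
    rwa [inv_inv, add_comm ‖z‖⁻¹] at this

theorem ofReal_mem_openEllipse {r : ℝ} (hr : 1 < r) {t : ℝ} (ht : t ∈ Icc (-1 : ℝ) 1) :
    (t : ℂ) ∈ openEllipse r := by
  have hsub : ‖(t : ℂ) - 1‖ = 1 - t := by
    rw [← Complex.ofReal_one, ← Complex.ofReal_sub, Complex.norm_real, Real.norm_eq_abs,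
      abs_of_nonpos (by linarith [ht.2])]; ring
  have hadd : ‖(t : ℂ) + 1‖ = t + 1 := by
    rw [← Complex.ofReal_one, ← Complex.ofReal_add, Complex.norm_real, Real.norm_eq_abs,
      abs_of_nonneg (by linarith [ht.1])]
  rw [mem_openEllipse, hsub, hadd]
  have hlt := add_inv_lt_add_inv le_rfl hr
  rw [inv_one] at hlt
  linarith

theorem ofReal_mem_bernsteinEllipse_one {t : ℝ} (ht : t ∈ Icc (-1 : ℝ) 1) :
    (t : ℂ) ∈ bernsteinEllipse 1 := by
  obtain ⟨z, hz, h⟩ := exists_joukowsky t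
  refine ⟨z, hz, ?_, h⟩
  by_contra! hlt
  have hmem := ofReal_mem_openEllipse hlt ht
  have hz0 : z ≠ 0 := norm_pos_iff.1 (by linarith)
  have hnorm := norm_joukowsky_sub_one_add_norm_add_one hz0
  rw [← h] at hnorm
  rw [mem_openEllipse] at hmem
  linarith

/-! ### Laurent coefficients in the Joukowsky variable -/

variable {g : ℂ → ℂ} {M r : ℝ}

/-- The Laurent coefficient of index `k` of `z ↦ g ((z + z⁻¹) / 2)`, a Fourier coefficient of
`θ ↦ g (cos θ)`. -/
noncomputable def joukowskyCoeff (g : ℂ → ℂ) (k : ℤ) : ℂ :=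
  (2 * Real.pi * Complex.I)⁻¹ • ∮ z in C(0, 1), z⁻¹ • (z ^ (-k) * g ((z + z⁻¹) / 2))

theorem differentiableAt_zpow_mul_comp_joukowsky (hr : 1 < r)
    (hg : ∀ w ∈ openEllipse r, DifferentiableAt ℂ g w) (k : ℤ) {z : ℂ} (hz1 : r⁻¹ < ‖z‖)
    (hz2 : ‖z‖ < r) : DifferentiableAt ℂ (fun z => z ^ k * g ((z + z⁻¹) / 2)) z := by
  have hz : z ≠ 0 := norm_pos_iff.1 (lt_trans (by positivity) hz1)
  refine (differentiableAt_zpow.2 (Or.inl hz)).mul ?_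
  refine DifferentiableAt.comp z (hg _ (joukowsky_mem_openEllipse hr hz1 hz2)) ?_
  exact (differentiableAt_id.add (differentiableAt_inv hz)).div_const 2

theorem circleIntegral_zpow_mul_comp_joukowsky_eq (hr : 1 < r)
    (hg : ∀ w ∈ openEllipse r, DifferentiableAt ℂ g w) (k : ℤ) {R₁ R₂ : ℝ} (h₁ : r⁻¹ < R₁)
    (h₁₂ : R₁ ≤ R₂) (h₂ : R₂ < r) :
    ∮ z in C(0, R₂), z⁻¹ • (z ^ k * g ((z + z⁻¹) / 2)) =
      ∮ z in C(0, R₁), z⁻¹ • (z ^ k * g ((z + z⁻¹) / 2)) := by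
  have hd {z : ℂ} (hz1 : R₁ ≤ ‖z‖) (hz2 : ‖z‖ ≤ R₂) :
      DifferentiableAt ℂ (fun z => z ^ k * g ((z + z⁻¹) / 2)) z :=
    differentiableAt_zpow_mul_comp_joukowsky hr hg k (h₁.trans_le hz1) (hz2.trans_lt h₂)
  have hR₁ : 0 < R₁ := lt_trans (by positivity) h₁
  simpa only [sub_zero] using
    Complex.circleIntegral_sub_center_inv_smul_eq_of_differentiable_on_annulus_off_countable
      (c := 0) hR₁ h₁₂ (s := ∅) countable_empty
      (fun z hz => (hd (by simpa using hz.2) (by simpa using hz.1)).continuousAt.continuousWithinAt)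
      (fun z hz => hd (by simpa using (not_le.1 (mt Metric.mem_closedBall.2 hz.1.2)).le)
        (by simpa using (Metric.mem_ball.1 hz.1.1).le))

theorem norm_joukowskyCoeff_le_zpow (hr : 1 < r)
    (hg : ∀ w ∈ openEllipse r, DifferentiableAt ℂ g w) (hM : ∀ w ∈ openEllipse r, ‖g w‖ ≤ M)
    (k : ℤ) {R : ℝ} (hR1 : r⁻¹ < R) (hR2 : R < r) : ‖joukowskyCoeff g k‖ ≤ M * R ^ (-k) := by
  have hR0 : 0 < R := lt_trans (by positivity) hR1
  have hcircle : ∮ z in C(0, 1), z⁻¹ • (z ^ (-k) * g ((z + z⁻¹) / 2))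
      = ∮ z in C(0, R), z⁻¹ • (z ^ (-k) * g ((z + z⁻¹) / 2)) := by
    rcases le_total R 1 with h | h
    · exact circleIntegral_zpow_mul_comp_joukowsky_eq hr hg _ hR1 h hr
    · exact (circleIntegral_zpow_mul_comp_joukowsky_eq hr hg _ (inv_lt_one_of_one_lt₀ hr) h
        hR2).symm
  have hnorm : ∀ z ∈ Metric.sphere (0 : ℂ) R,
      ‖z⁻¹ • (z ^ (-k) * g ((z + z⁻¹) / 2))‖ ≤ R⁻¹ * (R ^ (-k) * M) := fun z hz => by
    have hzR : ‖z‖ = R := by simpa using hz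
    rw [norm_smul, norm_inv, norm_mul, norm_zpow, hzR]
    gcongr
    exact hM _ (joukowsky_mem_openEllipse hr (by rwa [hzR]) (by rwa [hzR]))
  calc ‖joukowskyCoeff g k‖ ≤ R * (R⁻¹ * (R ^ (-k) * M)) := by
        rw [joukowskyCoeff, hcircle]
        exact circleIntegral.norm_two_pi_i_inv_smul_integral_le_of_norm_le_const hR0.le hnorm
    _ = M * R ^ (-k) := by field_simp

theorem norm_joukowskyCoeff_le (hr : 1 < r)
    (hg : ∀ w ∈ openEllipse r, DifferentiableAt ℂ g w) (hM : ∀ w ∈ openEllipse r, ‖g w‖ ≤ M)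
    (k : ℤ) : ‖joukowskyCoeff g k‖ ≤ M * r⁻¹ ^ k.natAbs := by
  have hr0 : 0 < r := by linarith
  have hlim : Filter.Tendsto (fun R : ℝ => M * R⁻¹ ^ k.natAbs) (nhdsWithin r (Iio r))
      (nhds (M * r⁻¹ ^ k.natAbs)) :=
    tendsto_nhdsWithin_of_tendsto_nhds (((tendsto_inv₀ hr0.ne').pow _).const_mul M)
  refine ge_of_tendsto hlim ?_
  filter_upwards [Ioo_mem_nhdsLT hr] with R hR
  have hR0 : 0 < R := by linarith [hR.1]
  have hinv : R⁻¹ < 1 := inv_lt_one_of_one_lt₀ hR.1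
  rcases Int.natAbs_eq k with h | h
  · refine (norm_joukowskyCoeff_le_zpow hr hg hM k (R := R)
      ((inv_lt_one_of_one_lt₀ hr).trans hR.1) hR.2).trans_eq ?_
    rw [inv_pow, ← zpow_natCast R, ← zpow_neg, ← h]
  · refine (norm_joukowskyCoeff_le_zpow hr hg hM k (R := R⁻¹)
      (inv_strictAnti₀ hR0 hR.2) (by linarith)).trans_eq ?_
    rw [← zpow_natCast R⁻¹, ← neg_eq_iff_eq_neg.2 h]

theorem periodic_comp_cos (g : ℂ → ℂ) :
    Function.Periodic (fun θ : ℝ => g (Real.cos θ)) (2 * Real.pi) := fun θ => by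
  simp only [Real.cos_add_two_pi]

theorem joukowsky_circleMap (θ : ℝ) :
    (circleMap 0 1 θ + (circleMap 0 1 θ)⁻¹) / 2 = (Real.cos θ : ℂ) := by
  rw [circleMap_zero, Complex.ofReal_one, one_mul, ← Complex.exp_neg, Complex.ofReal_cos,
    Complex.cos, neg_mul]

theorem fourier_two_pi_apply (k : ℤ) (θ : ℝ) :
    fourier k (θ : AddCircle (2 * Real.pi)) = circleMap 0 1 θ ^ k := by
  have hpi : (Real.pi : ℂ) ≠ 0 := by exact_mod_cast Real.pi_ne_zero
  rw [fourier_coe_apply, circleMap_zero, Complex.ofReal_one, one_mul, ← Complex.exp_int_mul]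
  congr 1
  push_cast
  field_simp

section Fourier

variable [Fact (0 < 2 * Real.pi)]

theorem fourierCoeff_lift_comp_cos (g : ℂ → ℂ) (k : ℤ) :
    fourierCoeff (periodic_comp_cos g).lift k = joukowskyCoeff g k := by
  have hpi : (Real.pi : ℂ) ≠ 0 := by exact_mod_cast Real.pi_ne_zero
  have hintegrand (θ : ℝ) : deriv (circleMap 0 1) θ • ((circleMap 0 1 θ)⁻¹ •
      (circleMap 0 1 θ ^ (-k) * g ((circleMap 0 1 θ + (circleMap 0 1 θ)⁻¹) / 2))) =
      Complex.I * (fourier (-k) (θ : AddCircle (2 * Real.pi)) •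
        (periodic_comp_cos g).lift (θ : AddCircle (2 * Real.pi))) := by
    have hne : circleMap 0 1 θ ≠ 0 := circleMap_ne_center one_ne_zero
    rw [joukowsky_circleMap, fourier_two_pi_apply, Function.Periodic.lift_coe, deriv_circleMap]
    simp only [smul_eq_mul]
    field_simp
  rw [fourierCoeff_eq_intervalIntegral _ _ 0, joukowskyCoeff, circleIntegral, zero_add]
  simp_rw [hintegrand, intervalIntegral.integral_const_mul, Complex.real_smul, smul_eq_mul]
  push_cast
  field_simp

theorem hasSum_joukowskyCoeff_mul_cos (hg : Continuous fun θ : ℝ => g (Real.cos θ))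
    (hsum : Summable (joukowskyCoeff g)) (θ : ℝ) :
    HasSum (fun k : ℤ => joukowskyCoeff g k * Complex.cos (k * θ)) (g (Real.cos θ)) := by
  let f : C(AddCircle (2 * Real.pi), ℂ) := ⟨(periodic_comp_cos g).lift, hg.quotient_lift _⟩
  have hcoeff : fourierCoeff f = joukowskyCoeff g := funext (fourierCoeff_lift_comp_cos g)
  have hseries (x : ℝ) :
      HasSum (fun k : ℤ => joukowskyCoeff g k * Complex.exp (k * (x * Complex.I)))
        (g (Real.cos x)) := by
    have h : HasSum _ (g (Real.cos x)) := has_pointwise_sum_fourier_series_of_summable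
      (f := f) (hcoeff ▸ hsum) (x : AddCircle (2 * Real.pi))
    simpa only [hcoeff, fourier_two_pi_apply, circleMap_zero, Complex.ofReal_one, one_mul,
      ← Complex.exp_int_mul, smul_eq_mul] using h
  have hmean := ((hseries θ).add (hseries (-θ))).div_const 2
  rw [Real.cos_neg, add_self_div_two] at hmean
  refine hmean.congr_fun fun k => ?_
  rw [Complex.cos, ← mul_add, mul_div_assoc]
  push_cast
  ring_nf

end Fourier

/-! ### Polynomial approximation on the interval -/

theorem eval_sum_chebyshev (a : ℤ → ℂ) (n : ℕ) (θ : ℝ) :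
    (∑ k ∈ Finset.range n, C (a k + a (-k)) * Chebyshev.T ℂ k - C (a 0)).eval
        (Real.cos θ : ℂ) =
      ∑ k ∈ Finset.range n, (a k * Complex.cos ((k : ℤ) * θ) +
        a (-k) * Complex.cos ((-k : ℤ) * θ)) - a 0 := by
  simp only [eval_sub, eval_finsetSum, eval_mul, eval_C, Complex.ofReal_cos,
    Chebyshev.T_complex_cos]
  congr 1
  refine Finset.sum_congr rfl fun k _ => ?_
  push_cast
  rw [neg_mul, Complex.cos_neg, add_mul]

theorem natDegree_sum_chebyshev_lt (a : ℤ → ℂ) {n : ℕ} (hn : 0 < n) :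
    (∑ k ∈ Finset.range n, C (a k + a (-k)) * Chebyshev.T ℂ k - C (a 0)).natDegree < n := by
  refine (natDegree_sub_le_of_le (m := n - 1) (n := 0)
    (natDegree_sum_le_of_forall_le _ _ fun k hk => ?_) (natDegree_C _).le).trans_lt (by omega)
  refine (natDegree_C_mul_le _ _).trans ?_
  rw [Chebyshev.natDegree_T, Int.natAbs_natCast]
  exact Nat.le_sub_one_of_lt (Finset.mem_range.1 hk)

theorem norm_cos_int_mul_le (k : ℤ) (θ : ℝ) : ‖Complex.cos (k * θ)‖ ≤ 1 := by
  rw [← Complex.ofReal_intCast, ← Complex.ofReal_mul, ← Complex.ofReal_cos, Complex.norm_real]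
  exact Real.abs_cos_le_one _

theorem exists_polynomial_norm_sub_le_of_hasSum_cos {a : ℤ → ℂ} {q : ℝ} (hq : q < 1)
    (ha : ∀ k, ‖a k‖ ≤ M * q ^ k.natAbs)
    (hsum : ∀ θ : ℝ, HasSum (fun k : ℤ => a k * Complex.cos (k * θ)) (g (Real.cos θ)))
    {n : ℕ} (hn : 0 < n) :
    ∃ P : ℂ[X], P.natDegree < n ∧ ∀ x ∈ Icc (-1 : ℝ) 1,
      ‖P.eval (x : ℂ) - g x‖ ≤ 2 * M * q ^ n / (1 - q) := by
  refine ⟨_, natDegree_sum_chebyshev_lt a hn, fun x hx => ?_⟩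
  have hterm (k : ℤ) (θ : ℝ) : ‖a k * Complex.cos (k * θ)‖ ≤ M * q ^ k.natAbs := by
    rw [norm_mul]
    exact (mul_le_of_le_one_right (norm_nonneg _) (norm_cos_int_mul_le k θ)).trans (ha k)
  have hpair (θ : ℝ) (k : ℕ) : ‖a k * Complex.cos ((k : ℤ) * θ) +
      a (-k) * Complex.cos ((-k : ℤ) * θ)‖ ≤ 2 * M * q ^ k := by
    refine (norm_add_le_of_le (hterm k θ) (hterm (-k) θ)).trans_eq ?_
    rw [Int.natAbs_neg, Int.natAbs_natCast]
    ring
  have htail := norm_sub_le_of_geometric_bound_of_hasSum hq (hpair (Real.arccos x))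
    (hsum (Real.arccos x)).nat_add_neg n
  rw [← Real.cos_arccos hx.1 hx.2, eval_sum_chebyshev]
  simpa only [Int.cast_zero, zero_mul, Complex.cos_zero, mul_one, sub_sub, add_comm] using htail

theorem exists_polynomial_norm_sub_le (hr : 1 < r)
    (hg : ∀ w ∈ openEllipse r, DifferentiableAt ℂ g w) (hM : ∀ w ∈ openEllipse r, ‖g w‖ ≤ M)
    {n : ℕ} (hn : 0 < n) :
    ∃ P : ℂ[X], P.natDegree < n ∧ ∀ x ∈ Icc (-1 : ℝ) 1,
      ‖P.eval (x : ℂ) - g x‖ ≤ 2 * M * r⁻¹ ^ n / (1 - r⁻¹) := by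
  have : Fact (0 < 2 * Real.pi) := ⟨Real.two_pi_pos⟩
  have hq : r⁻¹ < 1 := inv_lt_one_of_one_lt₀ hr
  have hcont : Continuous fun θ : ℝ => g (Real.cos θ) := continuous_iff_continuousAt.2 fun θ =>
    ContinuousAt.comp (g := g) (f := fun θ : ℝ => (Real.cos θ : ℂ))
      (hg _ (ofReal_mem_openEllipse hr ⟨Real.neg_one_le_cos θ, Real.cos_le_one θ⟩)).continuousAt
      (by fun_prop)
  have hle := norm_joukowskyCoeff_le hr hg hM
  have hgeo := summable_geometric_of_lt_one (by positivity) hq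
  have hsum : Summable (joukowskyCoeff g) := .of_norm_bounded (.mul_left M
    (.of_nat_of_neg (f := fun k : ℤ => r⁻¹ ^ k.natAbs) (by simpa using hgeo) (by simpa using hgeo)))
    hle
  exact exists_polynomial_norm_sub_le_of_hasSum_cos hq hle
    (hasSum_joukowskyCoeff_mul_cos hcont hsum) hn

end Ellipses

/-! ### Orthonormal polynomials -/

section OrthonormalPolynomials

open Polynomial

theorem integrable_of_continuous {X E : Type*} [TopologicalSpace X] [CompactSpace X]
    [MeasurableSpace X] [OpensMeasurableSpace X] [NormedAddCommGroup E]
    {μ : Measure X} [IsFiniteMeasure μ] {f : X → E} (hf : Continuous f) : Integrable f μ :=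
  hf.integrable_of_hasCompactSupport (HasCompactSupport.of_compactSpace f)

variable (μ : Measure (Icc (-1 : ℝ) 1))

theorem integrable_eval_mul_eval [IsFiniteMeasure μ] (p q : ℝ[X]) :
    Integrable (fun x : Icc (-1 : ℝ) 1 => p.eval (x : ℝ) * q.eval (x : ℝ)) μ :=
  integrable_of_continuous (by fun_prop)

variable [IsProbabilityMeasure μ] [NullSingletonClass μ]

theorem eq_zero_of_integral_eval_mul_self_eq_zero {p : ℝ[X]}
    (h : ∫ x, p.eval (x : ℝ) * p.eval (x : ℝ) ∂μ = 0) : p = 0 := by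
  by_contra hp
  have hroots : {x : Icc (-1 : ℝ) 1 | p.eval (x : ℝ) = 0}.Finite := by
    refine Set.Finite.of_finite_image ((p.roots.toFinset.finite_toSet).subset ?_)
      Subtype.val_injective.injOn
    rintro _ ⟨x, hx, rfl⟩
    simpa [hp] using hx
  rw [integral_eq_zero_iff_of_nonneg (fun x => mul_self_nonneg _)
    (integrable_eval_mul_eval μ p p)] at h
  have hne : ∀ᵐ x : Icc (-1 : ℝ) 1 ∂μ, p.eval (x : ℝ) ≠ 0 := by
    simpa [ae_iff] using hroots.measure_zero μ
  obtain ⟨x, hx, hx'⟩ := (h.and hne).exists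
  exact hx' (mul_self_eq_zero.1 hx)

/-- The inner product `∫ p q ∂μ` of real polynomials, definite because a nonzero polynomial has
finitely many zeros. -/
noncomputable abbrev polynomialInnerCore : InnerProductSpace.Core ℝ ℝ[X] where
  inner p q := ∫ x, p.eval (x : ℝ) * q.eval (x : ℝ) ∂μ
  conj_inner_symm p q := by simp [mul_comm]
  re_inner_nonneg p := integral_nonneg fun x => mul_self_nonneg _
  add_left p q t := by
    simp only [eval_add, add_mul]
    exact integral_add (integrable_eval_mul_eval μ _ _) (integrable_eval_mul_eval μ _ _)
  smul_left p q t := by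
    simp only [eval_smul, smul_eq_mul, mul_assoc, integral_const_mul]
    rfl
  definite p h := eq_zero_of_integral_eval_mul_self_eq_zero μ h

/-- The norm attached to `polynomialInnerCore`. -/
noncomputable abbrev polynomialNormedAddCommGroup : NormedAddCommGroup ℝ[X] :=
  (polynomialInnerCore μ).toNormedAddCommGroup

/-- The inner product space attached to `polynomialInnerCore`. -/
noncomputable abbrev polynomialInnerProductSpace :
    @InnerProductSpace ℝ ℝ[X] _ (polynomialNormedAddCommGroup μ).toSeminormedAddCommGroup :=
  letI := polynomialNormedAddCommGroup μ
  InnerProductSpace.ofCore (polynomialInnerCore μ).toCore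

/-- The orthonormal polynomials of the measure `μ`, obtained from the powers of `X` by the
Gram–Schmidt process. For the uniform measure they are the normalized Legendre polynomials. -/
noncomputable def orthonormalPolynomial (n : ℕ) : ℝ[X] :=
  letI := polynomialNormedAddCommGroup μ
  letI := polynomialInnerProductSpace μ
  InnerProductSpace.gramSchmidtNormed ℝ (fun k : ℕ => (X ^ k : ℝ[X])) n

theorem orthonormalPolynomial_zero : orthonormalPolynomial μ 0 = 1 := by
  let _ := polynomialNormedAddCommGroup μ
  let _ := polynomialInnerProductSpace μ
  have hnorm : ‖(1 : ℝ[X])‖ = 1 := by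
    rw [← sq_eq_sq₀ (norm_nonneg _) zero_le_one, ← real_inner_self_eq_norm_sq]
    change ∫ x, (1 : ℝ[X]).eval (x : ℝ) * (1 : ℝ[X]).eval (x : ℝ) ∂μ = _
    simp
  have hzero : InnerProductSpace.gramSchmidt ℝ (fun k : ℕ => (X ^ k : ℝ[X])) 0 = 1 := by
    rw [← Nat.bot_eq_zero, InnerProductSpace.gramSchmidt_bot, Nat.bot_eq_zero, pow_zero]
  rw [orthonormalPolynomial, InnerProductSpace.gramSchmidtNormed, hzero, hnorm]
  simp

theorem integral_orthonormalPolynomial_mul (m n : ℕ) :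
    ∫ x, (orthonormalPolynomial μ m).eval (x : ℝ) * (orthonormalPolynomial μ n).eval (x : ℝ) ∂μ =
      if m = n then 1 else 0 := by
  let _ := polynomialNormedAddCommGroup μ
  let _ := polynomialInnerProductSpace μ
  have hli : LinearIndependent ℝ (fun k : ℕ => (X ^ k : ℝ[X])) := by
    simpa only [coe_basisMonomials, monomial_one_right_eq_X_pow] using
      (basisMonomials ℝ).linearIndependent
  exact orthonormal_iff_ite.1 (InnerProductSpace.gramSchmidtNormed_orthonormal hli) m n

theorem span_orthonormalPolynomial_Iic (n : ℕ) :
    Submodule.span ℝ (orthonormalPolynomial μ '' Iic n) =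
      Submodule.span ℝ ((fun k : ℕ => (X ^ k : ℝ[X])) '' Iic n) := by
  let _ := polynomialNormedAddCommGroup μ
  let _ := polynomialInnerProductSpace μ
  exact (InnerProductSpace.span_gramSchmidtNormed _ _).trans
    (InnerProductSpace.span_gramSchmidt_Iic ℝ _ n)

theorem integral_pow_mul_orthonormalPolynomial {k n : ℕ} (h : k < n) :
    ∫ x, (x : ℝ) ^ k * (orthonormalPolynomial μ n).eval (x : ℝ) ∂μ = 0 := by
  have horth : ∀ p ∈ Submodule.span ℝ (orthonormalPolynomial μ '' Iic k),
      ∫ x, p.eval (x : ℝ) * (orthonormalPolynomial μ n).eval (x : ℝ) ∂μ = 0 := by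
    intro p hp
    induction hp using Submodule.span_induction with
    | mem p hp =>
      obtain ⟨m, hm, rfl⟩ := hp
      rw [integral_orthonormalPolynomial_mul, if_neg ((mem_Iic.1 hm).trans_lt h).ne]
    | zero => simp
    | add p q _ _ hp hq =>
      simp only [eval_add, add_mul]
      rw [integral_add (integrable_eval_mul_eval μ _ _) (integrable_eval_mul_eval μ _ _), hp, hq,
        add_zero]
    | smul a p _ hp =>
      simp only [eval_smul, smul_eq_mul, mul_assoc, integral_const_mul, hp, mul_zero]
  rw [span_orthonormalPolynomial_Iic] at horth
  simpa using horth _ (Submodule.subset_span ⟨k, mem_Iic.2 le_rfl, rfl⟩)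

theorem integral_eval_mul_orthonormalPolynomial {P : ℂ[X]} {n : ℕ} (hP : P.natDegree < n) :
    ∫ x : Icc (-1 : ℝ) 1,
      P.eval ((x : ℝ) : ℂ) * (((orthonormalPolynomial μ n).eval (x : ℝ) : ℝ) : ℂ) ∂μ = 0 := by
  simp_rw [eval_eq_sum_range' hP, Finset.sum_mul]
  rw [integral_finsetSum _ fun k _ => integrable_of_continuous (by fun_prop)]
  refine Finset.sum_eq_zero fun k hk => ?_
  simp_rw [mul_assoc, ← Complex.ofReal_pow, ← Complex.ofReal_mul]
  rw [integral_const_mul, integral_complex_ofReal,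
    integral_pow_mul_orthonormalPolynomial μ (Finset.mem_range.1 hk), Complex.ofReal_zero, mul_zero]

theorem integral_abs_orthonormalPolynomial_le (n : ℕ) :
    ∫ x, |(orthonormalPolynomial μ n).eval (x : ℝ)| ∂μ ≤ 1 := by
  set p := orthonormalPolynomial μ n with hp
  have hle (x : Icc (-1 : ℝ) 1) :
      |p.eval (x : ℝ)| ≤ (p.eval (x : ℝ) * p.eval (x : ℝ) + 1) / 2 := by
    nlinarith [sq_nonneg (|p.eval (x : ℝ)| - 1), abs_mul_abs_self (p.eval (x : ℝ))]
  refine (integral_mono (integrable_of_continuous (by fun_prop))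
    (integrable_of_continuous (by fun_prop)) hle).trans_eq ?_
  rw [integral_div, integral_add (integrable_eval_mul_eval μ _ _) (integrable_const _), hp,
    integral_orthonormalPolynomial_mul]
  simp

theorem norm_integral_mul_orthonormalPolynomial_le {h : Icc (-1 : ℝ) 1 → ℂ} {B : ℝ}
    (hB : ∀ x, ‖h x‖ ≤ B) (n : ℕ) :
    ‖∫ x, h x * (((orthonormalPolynomial μ n).eval (x : ℝ) : ℝ) : ℂ) ∂μ‖ ≤ B := by
  have hB0 : 0 ≤ B := (norm_nonneg _).trans (hB ⟨0, by norm_num⟩)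
  calc _ ≤ ∫ x : Icc (-1 : ℝ) 1, B * |(orthonormalPolynomial μ n).eval (x : ℝ)| ∂μ := by
        refine norm_integral_le_of_norm_le (integrable_of_continuous (by fun_prop))
          (ae_of_all _ fun x => ?_)
        rw [norm_mul, Complex.norm_real, Real.norm_eq_abs]
        exact mul_le_mul_of_nonneg_right (hB x) (abs_nonneg _)
    _ ≤ B := by
        rw [integral_const_mul]
        exact mul_le_of_le_one_right hB0 (integral_abs_orthonormalPolynomial_le μ n)

/-- The open Bernstein ellipse together with the segment `[-1,1]`, which the open ellipse with
parameter `1` misses. -/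
def ellipseDomain (r : ℝ) : Set ℂ := openEllipse r ∪ (↑) '' Icc (-1 : ℝ) 1

theorem ofReal_mem_ellipseDomain (r : ℝ) (x : Icc (-1 : ℝ) 1) :
    ((x : ℝ) : ℂ) ∈ ellipseDomain r :=
  Or.inr ⟨x, x.2, rfl⟩

theorem ellipseDomain_subset_bernsteinEllipse {r : ℝ} (hr : 1 ≤ r) :
    ellipseDomain r ⊆ bernsteinEllipse r := by
  refine union_subset (openEllipse_subset_bernsteinEllipse hr) ?_
  rintro _ ⟨t, ht, rfl⟩
  obtain ⟨z, hz, hz', h⟩ := ofReal_mem_bernsteinEllipse_one ht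
  exact ⟨z, hz, hz'.trans hr, h⟩

variable {g : ℂ → ℂ} {M r : ℝ}

theorem norm_integral_mul_orthonormalPolynomial_le_geometric (hr : 1 < r)
    (hg : ∀ w ∈ openEllipse r, DifferentiableAt ℂ g w) (hM : ∀ w ∈ openEllipse r, ‖g w‖ ≤ M)
    {n : ℕ} (hn : 0 < n) :
    ‖∫ x : Icc (-1 : ℝ) 1, g (x : ℝ) * (((orthonormalPolynomial μ n).eval (x : ℝ) : ℝ) : ℂ) ∂μ‖ ≤
      2 * M * r⁻¹ ^ n / (1 - r⁻¹) := by
  obtain ⟨P, hP, hgP⟩ := exists_polynomial_norm_sub_le hr hg hM hn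
  have hgc : Continuous fun x : Icc (-1 : ℝ) 1 => g (x : ℝ) :=
    continuous_iff_continuousAt.2 fun x =>
      ContinuousAt.comp (g := g) (f := fun x : Icc (-1 : ℝ) 1 => ((x : ℝ) : ℂ))
        (hg _ (ofReal_mem_openEllipse hr x.2)).continuousAt (by fun_prop)
  have hsub : ∫ x : Icc (-1 : ℝ) 1,
      (g (x : ℝ) - P.eval ((x : ℝ) : ℂ)) *
        (((orthonormalPolynomial μ n).eval (x : ℝ) : ℝ) : ℂ) ∂μ =
      ∫ x : Icc (-1 : ℝ) 1,
        g (x : ℝ) * (((orthonormalPolynomial μ n).eval (x : ℝ) : ℝ) : ℂ) ∂μ := by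
    simp_rw [sub_mul]
    rw [integral_sub, integral_eval_mul_orthonormalPolynomial μ hP, sub_zero]
    · exact integrable_of_continuous (hgc.mul (by fun_prop))
    · exact integrable_of_continuous (by fun_prop)
  rw [← hsub]
  refine norm_integral_mul_orthonormalPolynomial_le μ
    (h := fun x => g (x : ℝ) - P.eval ((x : ℝ) : ℂ)) (fun x => ?_) n
  rw [norm_sub_rev]
  exact hgP x x.2

theorem norm_integral_mul_orthonormalPolynomial_le_coeffDecay
    (hg : ∀ w ∈ openEllipse r, DifferentiableAt ℂ g w) (hM : ∀ w ∈ ellipseDomain r, ‖g w‖ ≤ M)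
    (n : ℕ) :
    ‖∫ x : Icc (-1 : ℝ) 1, g (x : ℝ) * (((orthonormalPolynomial μ n).eval (x : ℝ) : ℝ) : ℂ) ∂μ‖ ≤
      M * coeffDecay r n := by
  have hM0 : 0 ≤ M :=
    (norm_nonneg _).trans (hM _ (ofReal_mem_ellipseDomain r ⟨0, by norm_num⟩))
  have htrivial := norm_integral_mul_orthonormalPolynomial_le μ
    (fun x => hM _ (ofReal_mem_ellipseDomain r x)) n
  rcases n.eq_zero_or_pos with rfl | hn
  · rwa [coeffDecay_zero, mul_one]
  rw [coeffDecay]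
  split_ifs with hr
  · rw [mul_min_of_nonneg _ _ hM0, mul_one]
    refine le_min htrivial ((norm_integral_mul_orthonormalPolynomial_le_geometric μ hr hg
      (fun w hw => hM w (Or.inl hw)) hn).trans_eq ?_)
    ring
  · rwa [mul_one]

end OrthonormalPolynomials

/-! ### Resampling one variable of a product measure -/

section ProductMeasure

variable {ι : Type*} {X : ι → Type*} [∀ i, MeasurableSpace (X i)]
  (μ : ∀ i, Measure (X i)) [∀ i, IsProbabilityMeasure (μ i)]

theorem integral_prod_infinitePi {𝕜 : Type*} [RCLike 𝕜] (S : Finset ι) {f : ∀ i, X i → 𝕜}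
    (hf : ∀ i, AEStronglyMeasurable (f i) (μ i)) :
    ∫ y, ∏ i ∈ S, f i (y i) ∂Measure.infinitePi μ = ∏ i ∈ S, ∫ x, f i x ∂μ i := by
  have hm : AEStronglyMeasurable (fun y : ∀ i : S, X i => ∏ i : S, f i (y i))
      (Measure.pi fun i : S => μ i) :=
    Finset.aestronglyMeasurable_fun_prod _ fun i _ =>
      (hf i).comp_quasiMeasurePreserving 
        (Measure.quasiMeasurePreserving_eval (fun k : S => μ k) i)
  rw [← Finset.prod_coe_sort S, ← integral_fintype_prod_eq_prod (fun i : S => f i),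
    ← integral_restrict_infinitePi μ hm]
  exact integral_congr_ae (ae_of_all _ fun y => (Finset.prod_coe_sort S fun i => f i (y i)).symm)

variable [DecidableEq ι]

theorem measurePreserving_update (j : ι) :
    MeasurePreserving (fun q : (∀ i, X i) × X j => Function.update q.1 j q.2)
      ((Measure.infinitePi μ).prod (μ j)) (Measure.infinitePi μ) := by
  have hm : Measurable fun q : (∀ i, X i) × X j => Function.update q.1 j q.2 := measurable_update'
  refine ⟨hm, Measure.eq_infinitePi _ fun s t ht => ?_⟩
  have hpre : (fun q : (∀ i, X i) × X j => Function.update q.1 j q.2) ⁻¹' (s : Set ι).pi t =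
      ((s.erase j : Finset ι) : Set ι).pi t ×ˢ {x | j ∈ s → x ∈ t j} := by
    ext ⟨y, x⟩
    simp only [mem_preimage, Set.mem_pi, Finset.mem_coe, mem_prod, Finset.mem_erase,
      mem_ofPred_eq]
    refine ⟨fun h => ⟨fun i hi => ?_, fun hj => by simpa using h j hj⟩, fun h i hi => ?_⟩
    · simpa [Function.update_of_ne hi.1] using h i hi.2
    · rcases eq_or_ne i j with rfl | hij
      · simpa using h.2 hi
      · simpa [Function.update_of_ne hij] using h.1 i ⟨hij, hi⟩
  rw [Measure.map_apply hm (MeasurableSet.pi s.countable_toSet fun i _ => ht i), hpre,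
    Measure.prod_prod, Measure.infinitePi_pi _ fun i _ => ht i]
  by_cases hj : j ∈ s
  · simp only [hj, true_implies, ofPred_mem_eq, Finset.prod_erase_mul]
  · simp [hj]

variable {E : Type*} [NormedAddCommGroup E] [NormedSpace ℝ E]

theorem integral_integral_update (j : ι) {f : (∀ i, X i) → E}
    (hf : Integrable f (Measure.infinitePi μ)) :
    ∫ y, ∫ x, f (Function.update y j x) ∂μ j ∂Measure.infinitePi μ =
      ∫ y, f y ∂Measure.infinitePi μ := by
  have hmp := measurePreserving_update μ j
  have hmap := integral_map (f := f) hmp.measurable.aemeasurable (by rw [hmp.map_eq]; exact hf.1)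
  rw [hmp.map_eq] at hmap
  rw [hmap]
  exact (integral_prod _ (hmp.integrable_comp_of_integrable hf)).symm

end ProductMeasure

/-! ### Integrals of bounded holomorphic functions -/

section ParametricIntegral

open Filter Topology

variable {α : Type*} [MeasurableSpace α] {μ : Measure α} {Ψ : ℂ → α → ℂ} {x₀ : ℂ} {U : Set ℂ}

theorem aestronglyMeasurable_deriv_of_differentiableAt (hU : U ∈ 𝓝 x₀)
    (hm : ∀ z ∈ U, AEStronglyMeasurable (Ψ z) μ)
    (hd : ∀ t, DifferentiableAt ℂ (fun z => Ψ z t) x₀) :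
    AEStronglyMeasurable (fun t => deriv (fun z => Ψ z t) x₀) μ := by
  have hfreq : ∀ᶠ z in 𝓝[≠] x₀, z ∈ U := mem_nhdsWithin_of_mem_nhds hU
  obtain ⟨u, hu, huU⟩ := exists_seq_forall_of_frequently hfreq.frequently
  refine aestronglyMeasurable_of_tendsto_ae atTop
    (f := fun n t => slope (fun z => Ψ z t) x₀ (u n)) (fun n => ?_)
    (ae_of_all _ fun t => (hd t).hasDerivAt.tendsto_slope.comp hu)
  simp only [slope_def_field, div_eq_mul_inv]
  exact ((hm _ (huU n)).sub (hm _ (mem_of_mem_nhds hU))).mul_const _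

theorem differentiableAt_integral_of_bounded [IsFiniteMeasure μ] {M : ℝ} (hU : U ∈ 𝓝 x₀)
    (hm : ∀ z ∈ U, AEStronglyMeasurable (Ψ z) μ)
    (hd : ∀ z ∈ U, ∀ t, DifferentiableAt ℂ (fun z => Ψ z t) z)
    (hb : ∀ z ∈ U, ∀ t, ‖Ψ z t‖ ≤ M) :
    DifferentiableAt ℂ (fun z => ∫ t, Ψ z t ∂μ) x₀ := by
  obtain ⟨ε, hε, hball⟩ := Metric.mem_nhds_iff.1 hU
  have hhalf : Metric.ball x₀ (ε / 2) ⊆ U := (Metric.ball_subset_ball (by linarith)).trans hball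
  have hderiv (t : α) (x : ℂ) (hx : x ∈ Metric.ball x₀ (ε / 2)) :
      ‖deriv (fun z => Ψ z t) x‖ ≤ M / (ε / 2) := by
    have hsub : Metric.closedBall x (ε / 2) ⊆ U := fun z hz => hball <| by
      rw [Metric.mem_ball] at hx ⊢
      linarith [dist_triangle z x x₀, Metric.mem_closedBall.1 hz]
    exact Complex.norm_deriv_le_of_forall_mem_sphere_norm_le (half_pos hε)
      (DifferentiableOn.diffContOnCl_ball (fun z hz => (hd z hz t).differentiableWithinAt) hsub)
      fun z hz => hb z (hsub (Metric.sphere_subset_closedBall hz)) t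
  have hx₀ := mem_of_mem_nhds hU
  exact (hasDerivAt_integral_of_dominated_loc_of_deriv_le
    (Metric.ball_mem_nhds x₀ (half_pos hε)) (eventually_of_mem hU hm)
    (.of_bound (hm _ hx₀) M (ae_of_all _ (hb _ hx₀)))
    (aestronglyMeasurable_deriv_of_differentiableAt hU hm (hd _ hx₀))
    (ae_of_all _ hderiv) (integrable_const _)
    (ae_of_all _ fun t x hx => (hd x (hhalf hx) t).hasDerivAt)).2.differentiableAt

end ParametricIntegral

/-! ### Tensor products of orthonormal polynomials -/

section TensorPolynomials

variable {ι : Type*} (μ : ι → Measure (Icc (-1 : ℝ) 1)) [∀ j, IsProbabilityMeasure (μ j)]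
  [∀ j, NullSingletonClass (μ j)]

/-- The coordinate `y ↦ y j` as an element of the algebra of continuous functions. -/
def coordinate (j : ι) : C(ι → Icc (-1 : ℝ) 1, ℝ) := ⟨fun y => (y j : ℝ), by fun_prop⟩

/-- The tensor product of the orthonormal polynomials of degree `ν j` in the variable `j`. -/
noncomputable def tensorPolynomial (ν : ι →₀ ℕ) : C(ι → Icc (-1 : ℝ) 1, ℝ) :=
  ν.prod fun j n => Polynomial.aeval (coordinate j) (orthonormalPolynomial (μ j) n)

theorem aeval_coordinate_apply (j : ι) (p : Polynomial ℝ) (y : ι → Icc (-1 : ℝ) 1) :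
    Polynomial.aeval (coordinate j) p y = p.eval (y j : ℝ) :=
  Polynomial.aeval_continuousMap_apply _ _ _

theorem tensorPolynomial_apply (ν : ι →₀ ℕ) (y : ι → Icc (-1 : ℝ) 1) :
    tensorPolynomial μ ν y = ν.prod fun j n => (orthonormalPolynomial (μ j) n).eval (y j : ℝ) := by
  simp only [tensorPolynomial, Finsupp.prod, ContinuousMap.coe_prod, Finset.prod_apply,
    aeval_coordinate_apply]

theorem tensorPolynomial_single_add_apply {j : ι} {ν : ι →₀ ℕ} (hj : j ∉ ν.support) (n : ℕ)
    (y : ι → Icc (-1 : ℝ) 1) :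
    tensorPolynomial μ (Finsupp.single j n + ν) y =
      (orthonormalPolynomial (μ j) n).eval (y j : ℝ) * tensorPolynomial μ ν y := by
  have hdisj : Disjoint (Finsupp.single j n).support ν.support :=
    (Finset.disjoint_singleton_left.2 hj).mono_left Finsupp.support_single_subset
  rw [tensorPolynomial_apply, tensorPolynomial_apply, Finsupp.prod_add_index_of_disjoint hdisj,
    Finsupp.prod_single_index (by rw [orthonormalPolynomial_zero, Polynomial.eval_one])]

theorem integral_tensorPolynomial_mul [DecidableEq ι] (ν η : ι →₀ ℕ) :
    ∫ y, tensorPolynomial μ ν y * tensorPolynomial μ η y ∂Measure.infinitePi μ =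
      if ν = η then 1 else 0 := by
  set S := ν.support ∪ η.support with hS
  have hprod (θ : ι →₀ ℕ) (hθ : θ.support ⊆ S) (y : ι → Icc (-1 : ℝ) 1) :
      tensorPolynomial μ θ y = ∏ j ∈ S, (orthonormalPolynomial (μ j) (θ j)).eval (y j : ℝ) := by
    rw [tensorPolynomial_apply]
    exact Finsupp.prod_of_support_subset _ hθ _ fun j _ => by
      rw [orthonormalPolynomial_zero, Polynomial.eval_one]
  simp_rw [hprod ν Finset.subset_union_left, hprod η Finset.subset_union_right,
    ← Finset.prod_mul_distrib]
  rw [integral_prod_infinitePi μ S (f := fun j x => (orthonormalPolynomial (μ j) (ν j)).eval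
    (x : ℝ) * (orthonormalPolynomial (μ j) (η j)).eval (x : ℝ))
    fun j => (integrable_eval_mul_eval (μ j) _ _).1]
  simp_rw [integral_orthonormalPolynomial_mul]
  split_ifs with h
  · simp [h]
  · obtain ⟨j, hj⟩ := Finsupp.ne_iff.1 h
    refine Finset.prod_eq_zero (i := j) ?_ (if_neg hj)
    rw [hS, Finset.mem_union, Finsupp.mem_support_iff, Finsupp.mem_support_iff]
    grind

theorem integral_abs_tensorPolynomial_le (ν : ι →₀ ℕ) :
    ∫ y, |tensorPolynomial μ ν y| ∂Measure.infinitePi μ ≤ 1 := by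
  simp_rw [tensorPolynomial_apply, Finsupp.prod, Finset.abs_prod]
  rw [integral_prod_infinitePi μ ν.support
    (f := fun j x => |(orthonormalPolynomial (μ j) (ν j)).eval (x : ℝ)|)
    fun j => Continuous.aestronglyMeasurable (by fun_prop)]
  exact Finset.prod_le_one (fun j _ => integral_nonneg fun x => abs_nonneg _)
    fun j _ => integral_abs_orthonormalPolynomial_le (μ j) (ν j)

theorem tensorPolynomial_update [DecidableEq ι] {j : ι} {ν : ι →₀ ℕ} (hj : j ∉ ν.support)
    (y : ι → Icc (-1 : ℝ) 1) (x : Icc (-1 : ℝ) 1) :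
    tensorPolynomial μ ν (Function.update y j x) = tensorPolynomial μ ν y := by
  rw [tensorPolynomial_apply, tensorPolynomial_apply]
  refine Finsupp.prod_congr fun i hi => ?_
  rw [Function.update_of_ne (ne_of_mem_of_not_mem hi hj)]

end TensorPolynomials

/-! ### Coefficient bounds in many variables -/

section CoefficientBounds

variable {ι : Type*}

/-- The product of the sets `ellipseDomain (r j)`. -/
def polyellipseDomain (r : ι → ℝ) : Set (ι → ℂ) := univ.pi fun j => ellipseDomain (r j)

/-- The inclusion of the real cube into the complex space. -/
def complexify (y : ι → Icc (-1 : ℝ) 1) : ι → ℂ := fun j => ((y j : ℝ) : ℂ)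

theorem complexify_mem_polyellipseDomain (r : ι → ℝ) (y : ι → Icc (-1 : ℝ) 1) :
    complexify y ∈ polyellipseDomain r :=
  fun j _ => ofReal_mem_ellipseDomain (r j) (y j)

variable [DecidableEq ι]

/-- Functions on `polyellipseDomain r` that are bounded by `M` and holomorphic with respect to each
variable in the interior of its ellipse. -/
structure BoundedHolomorphic (r : ι → ℝ) (M : ℝ) (F : (ι → ℂ) → ℂ) : Prop where
  norm_le : ∀ w ∈ polyellipseDomain r, ‖F w‖ ≤ M
  differentiableAt : ∀ w ∈ polyellipseDomain r, ∀ j, ∀ z ∈ openEllipse (r j),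
    DifferentiableAt ℂ (fun z => F (Function.update w j z)) z

theorem complexify_update (y : ι → Icc (-1 : ℝ) 1) (j : ι) (x : Icc (-1 : ℝ) 1) :
    complexify (Function.update y j x) = Function.update (complexify y) j ((x : ℝ) : ℂ) := by
  ext i
  rcases eq_or_ne i j with rfl | h
  · simp [complexify]
  · simp [complexify, h]

theorem update_mem_polyellipseDomain {r : ι → ℝ} {w : ι → ℂ} (hw : w ∈ polyellipseDomain r) {j : ι}
    {z : ℂ} (hz : z ∈ ellipseDomain (r j)) : Function.update w j z ∈ polyellipseDomain r :=
  (update_mem_pi_iff_of_mem hw).2 fun _ => hz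

theorem integral_update_mul_tensorPolynomial_mul (μ : ι → Measure (Icc (-1 : ℝ) 1))
    [∀ j, IsProbabilityMeasure (μ j)] [∀ j, NullSingletonClass (μ j)] {F : (ι → ℂ) → ℂ} {j : ι}
    {ν : ι →₀ ℕ} (hj : j ∉ ν.support) (n : ℕ) {h : (ι → Icc (-1 : ℝ) 1) → ℝ}
    (hh : ∀ y x, h (Function.update y j x) = h y) (y : ι → Icc (-1 : ℝ) 1) :
    ∫ x, F (complexify (Function.update y j x)) *
        ((tensorPolynomial μ (Finsupp.single j n + ν) (Function.update y j x) *
          h (Function.update y j x) : ℝ) : ℂ) ∂μ j =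
      (∫ x : Icc (-1 : ℝ) 1, F (Function.update (complexify y) j ((x : ℝ) : ℂ)) *
        (((orthonormalPolynomial (μ j) n).eval (x : ℝ) : ℝ) : ℂ) ∂μ j) *
        ((tensorPolynomial μ ν y * h y : ℝ) : ℂ) := by
  rw [← integral_mul_const]
  congr 1 with x
  rw [tensorPolynomial_single_add_apply μ hj, tensorPolynomial_update μ hj, hh,
    Function.update_self, complexify_update]
  push_cast
  ring

variable {r : ι → ℝ} {M : ℝ} {F : (ι → ℂ) → ℂ}

namespace BoundedHolomorphic

theorem continuous_update (hF : BoundedHolomorphic r M F) {w : ι → ℂ}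
    (hw : w ∈ polyellipseDomain r) {j : ι} (hj : 1 < r j) :
    Continuous fun x : Icc (-1 : ℝ) 1 => F (Function.update w j ((x : ℝ) : ℂ)) :=
  continuous_iff_continuousAt.2 fun x =>
    (hF.differentiableAt w hw j _ (ofReal_mem_openEllipse hj x.2)).continuousAt.comp
      (f := fun x : Icc (-1 : ℝ) 1 => ((x : ℝ) : ℂ)) (by fun_prop)

theorem integrate (hF : BoundedHolomorphic r M F) {j : ι} (hj : 1 < r j)
    (μ : Measure (Icc (-1 : ℝ) 1)) [IsProbabilityMeasure μ] [NullSingletonClass μ] (n : ℕ) :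
    BoundedHolomorphic r (M * coeffDecay (r j) n) fun w =>
      ∫ x : Icc (-1 : ℝ) 1, F (Function.update w j ((x : ℝ) : ℂ)) *
        (((orthonormalPolynomial μ n).eval (x : ℝ) : ℝ) : ℂ) ∂μ where
  norm_le w hw := norm_integral_mul_orthonormalPolynomial_le_coeffDecay μ
    (g := fun z => F (Function.update w j z)) (hF.differentiableAt w hw j)
    (fun _ hz => hF.norm_le _ (update_mem_polyellipseDomain hw hz)) n
  differentiableAt w hw i z hz := by
    rcases eq_or_ne i j with rfl | hij
    · simp only [Function.update_idem]
      exact differentiableAt_const _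
    have hmem {v : ℂ} (hv : v ∈ openEllipse (r i)) :
        Function.update w i v ∈ polyellipseDomain r :=
      update_mem_polyellipseDomain hw (Or.inl hv)
    obtain ⟨B, hB⟩ := isCompact_univ.exists_bound_of_continuousOn (f := fun x : Icc (-1 : ℝ) 1 =>
      (((orthonormalPolynomial μ n).eval (x : ℝ) : ℝ) : ℂ)) (by fun_prop)
    refine differentiableAt_integral_of_bounded (M := M * B)
      ((isOpen_openEllipse (r i)).mem_nhds hz) (fun v hv => ?_) (fun v hv x => ?_) fun v hv x => ?_
    · exact ((hF.continuous_update (hmem hv) hj).mul (by fun_prop)).aestronglyMeasurable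
    · simp only [Function.update_comm hij]
      exact (hF.differentiableAt _ (update_mem_polyellipseDomain hw
        (ofReal_mem_ellipseDomain (r j) x)) i v hv).mul_const _
    · have hle := hF.norm_le _ (update_mem_polyellipseDomain (hmem hv)
        (ofReal_mem_ellipseDomain (r j) x))
      rw [norm_mul]
      exact mul_le_mul hle (hB x (mem_univ x)) (norm_nonneg _) ((norm_nonneg _).trans hle)

variable [Countable ι] (μ : ι → Measure (Icc (-1 : ℝ) 1)) [∀ j, IsProbabilityMeasure (μ j)]

theorem integrable_mul (hF : BoundedHolomorphic r M F)
    (hm : AEStronglyMeasurable (fun y => F (complexify y)) (Measure.infinitePi μ))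
    (h : C(ι → Icc (-1 : ℝ) 1, ℝ)) :
    Integrable (fun y => F (complexify y) * (h y : ℂ)) (Measure.infinitePi μ) :=
  (integrable_of_continuous (f := fun y => (h y : ℂ)) (by fun_prop)).bdd_mul hm
    (ae_of_all _ fun y => hF.norm_le _ (complexify_mem_polyellipseDomain r y))

variable [∀ j, NullSingletonClass (μ j)]

theorem norm_integral_mul_tensorPolynomial_mul_le (hF : BoundedHolomorphic r M F)
    (hm : AEStronglyMeasurable (fun y => F (complexify y)) (Measure.infinitePi μ)) {ν : ι →₀ ℕ}
    (hr : ∀ j ∈ ν.support, 1 < r j) {h : C(ι → Icc (-1 : ℝ) 1, ℝ)}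
    (hh : ∀ j ∈ ν.support, ∀ y x, h (Function.update y j x) = h y) :
    ‖∫ y, F (complexify y) * ((tensorPolynomial μ ν y * h y : ℝ) : ℂ) ∂Measure.infinitePi μ‖ ≤
      M * (ν.prod fun j n => coeffDecay (r j) n) * ∫ y, |h y| ∂Measure.infinitePi μ := by
  induction ν using Finsupp.induction generalizing M F with
  | zero =>
    rw [Finsupp.prod_zero_index, mul_one, ← integral_const_mul]
    refine norm_integral_le_of_norm_le (integrable_of_continuous (by fun_prop))
      (ae_of_all _ fun y => ?_)
    rw [tensorPolynomial_apply, Finsupp.prod_zero_index, one_mul, norm_mul, Complex.norm_real,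
      Real.norm_eq_abs]
    exact mul_le_mul_of_nonneg_right
      (hF.norm_le _ (complexify_mem_polyellipseDomain r y)) (abs_nonneg _)
  | single_add j n ν hj hn ih =>
    have hdisj : Disjoint (Finsupp.single j n).support ν.support :=
      (Finset.disjoint_singleton_left.2 hj).mono_left Finsupp.support_single_subset
    rw [Finsupp.support_add_eq hdisj, Finsupp.support_single _ hn, Finset.singleton_union,
      Finset.forall_mem_insert] at hr hh
    have hresampled : AEStronglyMeasurable (fun q : (ι → Icc (-1 : ℝ) 1) × Icc (-1 : ℝ) 1 =>
        F (Function.update (complexify q.1) j ((q.2 : ℝ) : ℂ)) *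
          (((orthonormalPolynomial (μ j) n).eval (q.2 : ℝ) : ℝ) : ℂ))
        ((Measure.infinitePi μ).prod (μ j)) := by
      simp only [← complexify_update]
      exact (hm.comp_measurePreserving (measurePreserving_update μ j)).mul
        (Continuous.aestronglyMeasurable (by fun_prop))
    have hint := hF.integrable_mul μ hm (tensorPolynomial μ (Finsupp.single j n + ν) * h)
    simp only [ContinuousMap.mul_apply] at hint
    rw [← integral_integral_update μ j hint]
    simp only [integral_update_mul_tensorPolynomial_mul μ hj n hh.1]
    rw [Finsupp.prod_add_index_of_disjoint hdisj,
      Finsupp.prod_single_index (h := fun j n => coeffDecay (r j) n) (coeffDecay_zero (r j)),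
      ← mul_assoc]
    exact ih (hF.integrate hr.1 (μ j) n) hresampled.integral_prod_right' hr.2 hh.2

theorem norm_integral_mul_tensorPolynomial_le (hF : BoundedHolomorphic r M F)
    (hm : AEStronglyMeasurable (fun y => F (complexify y)) (Measure.infinitePi μ)) (ν : ι →₀ ℕ) :
    ‖∫ y, F (complexify y) * (tensorPolynomial μ ν y : ℂ) ∂Measure.infinitePi μ‖ ≤
      M * ν.prod fun j n => coeffDecay (r j) n := by
  have hsplit (y : ι → Icc (-1 : ℝ) 1) : tensorPolynomial μ ν y =
      tensorPolynomial μ (ν.filter fun j => 1 < r j) y *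
        tensorPolynomial μ (ν.filter fun j => ¬ 1 < r j) y := by
    simp only [tensorPolynomial_apply, Finsupp.prod_filter_mul_prod_filter_not]
  have hdecay : (ν.filter fun j => 1 < r j).prod (fun j n => coeffDecay (r j) n) =
      ν.prod fun j n => coeffDecay (r j) n := by
    rw [Finsupp.prod_filter_index, Finsupp.support_filter]
    exact Finset.prod_filter_of_ne fun j _ hne => not_imp_comm.1 (if_neg ·) hne
  simp only [hsplit]
  rw [← hdecay]
  refine (hF.norm_integral_mul_tensorPolynomial_mul_le μ hm (fun j hj => ?_)
    fun j hj y x => ?_).trans ?_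
  · rw [Finsupp.support_filter, Finset.mem_filter] at hj
    exact hj.2
  · rw [Finsupp.support_filter, Finset.mem_filter] at hj
    exact tensorPolynomial_update μ (by simp [hj.2]) y x
  · refine mul_le_of_le_one_right (mul_nonneg ?_ (prod_coeffDecay_nonneg _ _))
      (integral_abs_tensorPolynomial_le μ _)
    exact (norm_nonneg _).trans
      (hF.norm_le _ (complexify_mem_polyellipseDomain r fun _ => ⟨0, by norm_num⟩))

end BoundedHolomorphic

theorem polyellipseDomain_subset_region {b : ℕ → ℝ} (hb : ∀ j, 0 ≤ b j) {r : ℕ → ℝ}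
    (hr : r ∈ feasible b) : polyellipseDomain r ⊆ region b 1 := by
  have hnonneg (j : ℕ) : 0 ≤ ((r j + (r j)⁻¹) / 2 - 1) * b j :=
    mul_nonneg (joukowsky_sub_one_nonneg (zero_lt_one.trans_le (hr.1 j))) (hb j)
  have hsum := summable_of_sum_le hnonneg hr.2
  exact fun w hw => ⟨r, hr.1, hsum, hsum.tsum_le_of_sum_le hr.2,
    fun j => ellipseDomain_subset_bernsteinEllipse (hr.1 j) (hw j (mem_univ j))⟩

theorem HolomorphicIn.differentiableAt_update {O : Set (ℕ → ℂ)} {F : (ℕ → ℂ) → ℂ}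
    (hF : HolomorphicIn O F) {w : ℕ → ℂ} {j : ℕ} {z : ℂ} (hw : Function.update w j z ∈ O) :
    DifferentiableAt ℂ (fun z => F (Function.update w j z)) z := by
  have hshift : (fun z' => F (Function.update w j z')) =
      (fun h : ℂ => F (Function.update w j z + Pi.single j h)) ∘ fun z' => z' - z := by
    ext z'
    simp only [Function.comp_apply, Pi.single, ← Function.update_add, add_zero]
    simp
  rw [hshift]
  exact DifferentiableAt.comp _ (by simpa using hF _ hw j) (by fun_prop)

theorem abs_integral_mul_tensorPolynomial_le_coeffWeight {b : ℕ → ℝ} (hb : ∀ j, 0 ≤ b j)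
    {f : Cube → ℝ} (hf : f ∈ unitClass b) (μ : ℕ → Measure (Icc (-1 : ℝ) 1))
    [∀ j, IsProbabilityMeasure (μ j)] [∀ j, NullSingletonClass (μ j)]
    (hm : AEStronglyMeasurable f (Measure.infinitePi μ)) (ν : ℕ →₀ ℕ) :
    |∫ y, f y * tensorPolynomial μ ν y ∂Measure.infinitePi μ| ≤ coeffWeight b ν := by
  obtain ⟨F, hhol, hext, hbound⟩ := hf
  have hF (y : Cube) : F (complexify y) = (f y : ℂ) := hext y
  refine le_coeffWeight fun r hr => ?_
  have hsub := polyellipseDomain_subset_region hb hr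
  have hbdd : BoundedHolomorphic r 1 F := ⟨fun w hw => hbound w (hsub hw), fun w hw j z hz =>
    hhol.differentiableAt_update (hsub (update_mem_polyellipseDomain hw (Or.inl hz)))⟩
  have hle := hbdd.norm_integral_mul_tensorPolynomial_le μ (by
    simp only [hF]
    exact Complex.continuous_ofReal.comp_aestronglyMeasurable hm) ν
  simp only [hF, ← Complex.ofReal_mul, integral_complex_ofReal] at hle
  rwa [Complex.norm_real, Real.norm_eq_abs, one_mul] at hle

end CoefficientBounds

/-! ### The Hilbert basis of tensor polynomials -/

section HilbertBasis

variable {ι 𝕜 E : Type*} [RCLike 𝕜] [NormedAddCommGroup E] [InnerProductSpace 𝕜 E]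

theorem norm_sub_sum_inner_smul_le (B : HilbertBasis ι 𝕜 E) (Λ : Finset ι) (x : E) {T : ℝ}
    (hT : 0 ≤ T) (htail : ∀ u, Disjoint u Λ → ∑ i ∈ u, ‖inner 𝕜 (B i) x‖ ^ 2 ≤ T ^ 2) :
    ‖x - ∑ i ∈ Λ, inner 𝕜 (B i) x • B i‖ ≤ T := by
  classical
  have hsum : HasSum (fun i => inner 𝕜 (B i) x • B i) x := by
    simpa only [B.repr_apply_apply] using B.hasSum_repr x
  refine le_of_tendsto (Filter.Tendsto.sub_const hsum _).norm ?_
  filter_upwards [Filter.eventually_ge_atTop Λ] with u hu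
  rw [← Finset.sum_sdiff hu, add_sub_cancel_right, ← sq_le_sq₀ (norm_nonneg _) hT]
  simpa only [LinearIsometry.toSpanSingleton_apply] using
    (B.orthonormal.orthogonalFamily.norm_sum (fun i => inner 𝕜 (B i) x) (u \ Λ)).trans_le
      (htail _ Finset.sdiff_disjoint)

end HilbertBasis

section TensorBasis

variable {ι : Type*}

theorem finsupp_prod_mem_span {R A : Type*} [CommSemiring R] [CommSemiring A] [Algebra R A]
    {u v : ι → ℕ → A} (hv : ∀ j, v j 0 = 1)
    (huv : ∀ j n, u j n ∈ Submodule.span R (v j '' Iic n)) (ν : ι →₀ ℕ) :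
    ν.prod u ∈ Submodule.span R ((fun η : ι →₀ ℕ => η.prod v) '' Iic ν) := by
  classical
  induction ν using Finsupp.induction with
  | zero => exact Submodule.subset_span ⟨0, self_mem_Iic, by simp⟩
  | single_add j n ν hj hn ih =>
    have hdisj {k : ℕ} {η : ι →₀ ℕ} (hη : η ≤ ν) :
        Disjoint (Finsupp.single j k).support η.support :=
      (Finset.disjoint_singleton_left.2 fun h => hj (Finsupp.support_mono hη h)).mono_left
        Finsupp.support_single_subset
    have hmul := Submodule.mul_mem_mul (huv j n) ih
    rw [Submodule.span_mul_span] at hmul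
    rw [Finsupp.prod_add_index_of_disjoint (hdisj le_rfl), Finsupp.prod,
      Finsupp.support_single _ hn, Finset.prod_singleton, Finsupp.single_eq_same]
    refine Submodule.span_mono ?_ hmul
    rintro _ ⟨_, ⟨k, hk, rfl⟩, _, ⟨η, hη, rfl⟩, rfl⟩
    refine ⟨Finsupp.single j k + η, mem_Iic.2 (add_le_add (Finsupp.single_le_single.2 hk) hη), ?_⟩
    simp only
    rw [Finsupp.prod_add_index_of_disjoint (hdisj hη), Finsupp.prod_single_index (hv j)]

/-- The monomial with multi-index `ν`, as a continuous function on the cube. -/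
noncomputable def monomial (ν : ι →₀ ℕ) : C(ι → Icc (-1 : ℝ) 1, ℝ) :=
  ν.prod fun j n => coordinate j ^ n

theorem monomial_apply (ν : ι →₀ ℕ) (y : ι → Icc (-1 : ℝ) 1) :
    monomial ν y = ν.prod fun j n => (y j : ℝ) ^ n := by
  simp only [monomial, Finsupp.prod, ContinuousMap.coe_prod, Finset.prod_apply,
    ContinuousMap.pow_apply, coordinate, ContinuousMap.coe_mk]

theorem adjoin_range_coordinate_le_span_monomial :
    Subalgebra.toSubmodule (Algebra.adjoin ℝ (range (coordinate (ι := ι)))) ≤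
      Submodule.span ℝ (range monomial) := by
  rw [Algebra.adjoin_eq_span]
  refine Submodule.span_mono fun g hg => ?_
  induction hg using Submonoid.closure_induction with
  | mem g hg =>
    obtain ⟨j, rfl⟩ := hg
    exact ⟨Finsupp.single j 1, by simp [monomial]⟩
  | one => exact ⟨0, Finsupp.prod_zero_index⟩
  | mul g h _ _ hg hh =>
    obtain ⟨ν, rfl⟩ := hg
    obtain ⟨η, rfl⟩ := hh
    exact ⟨ν + η, Finsupp.prod_add_index' (fun _ => pow_zero _) fun _ => pow_add _⟩

theorem separatesPoints_adjoin_range_coordinate :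
    (Algebra.adjoin ℝ (range (coordinate (ι := ι)))).SeparatesPoints := fun x y hxy => by
  obtain ⟨j, hj⟩ := Function.ne_iff.1 hxy
  exact ⟨coordinate j, ⟨coordinate j, Algebra.subset_adjoin ⟨j, rfl⟩, rfl⟩,
    fun h => hj (Subtype.ext h)⟩

variable (μ : ι → Measure (Icc (-1 : ℝ) 1)) [∀ j, IsProbabilityMeasure (μ j)]
  [∀ j, NullSingletonClass (μ j)]

theorem aeval_coordinate_mem_span (j : ι) {p : Polynomial ℝ} {s : Set (Polynomial ℝ)}
    (hp : p ∈ Submodule.span ℝ s) :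
    Polynomial.aeval (coordinate j) p ∈
      Submodule.span ℝ (Polynomial.aeval (coordinate j) '' s) :=
  Submodule.apply_mem_span_image_of_mem_span (Polynomial.aeval (coordinate j)).toLinearMap hp

theorem tensorPolynomial_mem_span_monomial (ν : ι →₀ ℕ) :
    tensorPolynomial μ ν ∈ Submodule.span ℝ (monomial '' Iic ν) := by
  refine finsupp_prod_mem_span (fun j => pow_zero _) (fun j n => ?_) ν
  have hmem : orthonormalPolynomial (μ j) n ∈
      Submodule.span ℝ ((fun k : ℕ => (Polynomial.X ^ k : Polynomial ℝ)) '' Iic n) :=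
    span_orthonormalPolynomial_Iic (μ j) n ▸ Submodule.subset_span ⟨n, self_mem_Iic, rfl⟩
  simpa only [image_image, map_pow, Polynomial.aeval_X] using aeval_coordinate_mem_span j hmem

theorem exists_sum_monomial_eq {Λ : Finset (ι →₀ ℕ)} (hΛ : IsLowerSet (Λ : Set (ι →₀ ℕ)))
    (c : (ι →₀ ℕ) → ℝ) :
    ∃ d : (ι →₀ ℕ) → ℝ, ∑ ν ∈ Λ, d ν • monomial ν = ∑ ν ∈ Λ, c ν • tensorPolynomial μ ν := by
  refine (Submodule.mem_span_image_finset_iff_exists_fun' ℝ).1 <|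
    Submodule.sum_mem _ fun ν hν => Submodule.smul_mem _ _ ?_
  exact Submodule.span_mono (image_mono fun η hη => hΛ hη hν)
    (tensorPolynomial_mem_span_monomial μ ν)

theorem monomial_mem_span_tensorPolynomial (ν : ι →₀ ℕ) :
    monomial ν ∈ Submodule.span ℝ (range (tensorPolynomial μ)) := by
  refine Submodule.span_mono (image_subset_range _ (Iic ν))
    (finsupp_prod_mem_span (fun j => ?_) (fun j n => ?_) ν)
  · rw [orthonormalPolynomial_zero, map_one]
  · have hmem : (Polynomial.X ^ n : Polynomial ℝ) ∈
        Submodule.span ℝ (orthonormalPolynomial (μ j) '' Iic n) :=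
      span_orthonormalPolynomial_Iic (μ j) n ▸ Submodule.subset_span ⟨n, self_mem_Iic, rfl⟩
    simpa only [image_image, map_pow, Polynomial.aeval_X] using aeval_coordinate_mem_span j hmem

theorem topologicalClosure_span_tensorPolynomial :
    (Submodule.span ℝ (range (tensorPolynomial μ))).topologicalClosure = ⊤ := by
  have hle : Subalgebra.toSubmodule (Algebra.adjoin ℝ (range coordinate)) ≤
      Submodule.span ℝ (range (tensorPolynomial μ)) :=
    adjoin_range_coordinate_le_span_monomial.trans <| Submodule.span_le.2 <|
      range_subset_iff.2 (monomial_mem_span_tensorPolynomial μ)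
  have htop := ContinuousMap.subalgebra_topologicalClosure_eq_top_of_separatesPoints _
    (separatesPoints_adjoin_range_coordinate (ι := ι))
  refine top_le_iff.1 fun g _ => Submodule.topologicalClosure_mono hle ?_
  exact (htop ▸ Algebra.mem_top :
    g ∈ (Algebra.adjoin ℝ (range (coordinate (ι := ι)))).topologicalClosure)

variable [Countable ι]

/-- The tensor polynomials as elements of `L²`, where they form a Hilbert basis. -/
noncomputable def tensorLp (ν : ι →₀ ℕ) : Lp ℝ 2 (Measure.infinitePi μ) :=
  ContinuousMap.toLp 2 (Measure.infinitePi μ) ℝ (tensorPolynomial μ ν)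

theorem orthonormal_tensorLp : Orthonormal ℝ (tensorLp μ) := by
  classical
  refine orthonormal_iff_ite.2 fun ν η => ?_
  rw [tensorLp, tensorLp, ContinuousMap.inner_toLp, ← integral_tensorPolynomial_mul μ]
  simp only [conj_trivial, mul_comm]

theorem topologicalClosure_span_tensorLp :
    (Submodule.span ℝ (range (tensorLp μ))).topologicalClosure = ⊤ := by
  have h := (ContinuousMap.toLp_denseRange ℝ (Measure.infinitePi μ) ℝ
    (p := 2) (by norm_num)).topologicalClosure_map_submodule
      (topologicalClosure_span_tensorPolynomial μ)
  rwa [Submodule.map_span, ← range_comp] at h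

theorem inner_tensorLp_toLp {f : (ι → Icc (-1 : ℝ) 1) → ℝ} (hf : MemLp f 2 (Measure.infinitePi μ))
    (ν : ι →₀ ℕ) :
    inner ℝ (tensorLp μ ν) (hf.toLp f) =
      ∫ y, f y * tensorPolynomial μ ν y ∂Measure.infinitePi μ := by
  rw [L2.inner_def]
  refine integral_congr_ae ?_
  filter_upwards [hf.coeFn_toLp, ContinuousMap.coeFn_toLp (p := 2) (𝕜 := ℝ) _
    (tensorPolynomial μ ν)] with y hfy hpy
  rw [hfy, tensorLp, hpy, RCLike.inner_apply, conj_trivial]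

theorem exists_eLpNorm_sub_sum_monomial_le {Λ : Finset (ι →₀ ℕ)}
    (hΛ : IsLowerSet (Λ : Set (ι →₀ ℕ))) {f : (ι → Icc (-1 : ℝ) 1) → ℝ}
    (hf : MemLp f 2 (Measure.infinitePi μ)) {T : ℝ} (hT : 0 ≤ T)
    (htail : ∀ u, Disjoint u Λ →
      ∑ ν ∈ u, (∫ y, f y * tensorPolynomial μ ν y ∂Measure.infinitePi μ) ^ 2 ≤ T ^ 2) :
    ∃ d : (ι →₀ ℕ) → ℝ,
      eLpNorm (fun y => f y - ∑ ν ∈ Λ, d ν * monomial ν y) 2 (Measure.infinitePi μ) ≤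
        ENNReal.ofReal T := by
  let B := HilbertBasis.mk (orthonormal_tensorLp μ) (topologicalClosure_span_tensorLp μ).ge
  have hB : ⇑B = tensorLp μ := HilbertBasis.coe_mk _ _
  have hnorm := norm_sub_sum_inner_smul_le B Λ (hf.toLp f) hT fun u hu => by
    simpa only [hB, inner_tensorLp_toLp, Real.norm_eq_abs, sq_abs] using htail u hu
  obtain ⟨d, hd⟩ := exists_sum_monomial_eq μ hΛ fun ν => inner ℝ (tensorLp μ ν) (hf.toLp f)
  set q := ∑ ν ∈ Λ, d ν • monomial ν with hq
  have hproj : ContinuousMap.toLp 2 (Measure.infinitePi μ) ℝ q =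
      ∑ ν ∈ Λ, inner ℝ (B ν) (hf.toLp f) • B ν := by
    simp only [hd, map_sum, map_smul, hB, tensorLp]
  have hae : (fun y => f y - ∑ ν ∈ Λ, d ν * monomial ν y) =ᵐ[Measure.infinitePi μ]
      ⇑(hf.toLp f - ContinuousMap.toLp 2 (Measure.infinitePi μ) ℝ q) := by
    filter_upwards [Lp.coeFn_sub (hf.toLp f) (ContinuousMap.toLp 2 _ ℝ q), hf.coeFn_toLp,
      ContinuousMap.coeFn_toLp (p := 2) (𝕜 := ℝ) (Measure.infinitePi μ) q] with y hsub hfy hqy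
    rw [hsub, Pi.sub_apply, hfy, hqy, hq, ContinuousMap.sum_apply]
    simp only [ContinuousMap.smul_apply, smul_eq_mul]
  refine ⟨d, ?_⟩
  rw [eLpNorm_congr_ae hae, ← Lp.enorm_def, hproj, ← ofReal_norm]
  exact ENNReal.ofReal_le_ofReal hnorm

end TensorBasis

/-! ### Assembling the approximation theorem -/

section UnitClass

variable {b : ℕ → ℝ}

theorem abs_le_one_of_mem_unitClass {f : Cube → ℝ} (hf : f ∈ unitClass b) (y : Cube) :
    |f y| ≤ 1 := by
  obtain ⟨F, -, hFf, hFb⟩ := hf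
  have hle := hFb (fun j => ((y j : ℝ) : ℂ)) ⟨fun _ => 1, fun _ => le_rfl, by norm_num,
    by norm_num, fun j => ofReal_mem_bernsteinEllipse_one (y j).2⟩
  rwa [hFf, Complex.norm_real] at hle

theorem region_anti {b' : ℕ → ℝ} (h : ∀ j, |b j| ≤ b' j) (ε : ℝ) : region b' ε ⊆ region b ε := by
  rintro w ⟨r, hr, hsum, hle, hw⟩
  have hr0 j : 0 ≤ (r j + (r j)⁻¹) / 2 - 1 := joukowsky_sub_one_nonneg (one_pos.trans_le (hr j))
  have habs j : ‖((r j + (r j)⁻¹) / 2 - 1) * b j‖ ≤ ((r j + (r j)⁻¹) / 2 - 1) * b' j := by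
    rw [norm_mul, Real.norm_of_nonneg (hr0 j)]
    exact mul_le_mul_of_nonneg_left (h j) (hr0 j)
  have hs := hsum.of_norm_bounded habs
  exact ⟨r, hr, hs,
    (hs.tsum_le_tsum (fun j => (Real.le_norm_self _).trans (habs j)) hsum).trans hle, hw⟩

theorem unitClass_mono {b' : ℕ → ℝ} (h : ∀ j, |b j| ≤ b' j) : unitClass b ⊆ unitClass b' := by
  rintro f ⟨F, hd, hf, hF⟩
  exact ⟨F, fun z hz => hd z (region_anti h 1 hz), hf, fun z hz => hF z (region_anti h 1 hz)⟩

end UnitClass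

section PolynomialApproximation

theorem summable_rpow_of_memℓp {ι : Type*} {b : ι → ℝ} (hb : ∀ j, 0 ≤ b j) {p : ℝ} (hp : 0 < p)
    (h : Memℓp b (ENNReal.ofReal p)) : Summable fun j => b j ^ p := by
  simpa only [ENNReal.toReal_ofReal hp.le, Real.norm_of_nonneg (hb _)] using
    (memℓp_gen_iff (by rwa [ENNReal.toReal_ofReal hp.le])).1 h

theorem exists_sum_monomial_approximation {b : ℕ → ℝ} (hb : ∀ j, 0 < b j) {p : ℝ} (hp : 0 < p)
    (hp1 : p ≤ 1) (hbp : Memℓp b (ENNReal.ofReal p)) :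
    ∃ C : ℝ, 0 ≤ C ∧ ∀ s : ℕ, s ≠ 0 → ∃ Λ : Finset (ℕ →₀ ℕ), Λ.card ≤ s ∧
      IsLowerSet (Λ : Set (ℕ →₀ ℕ)) ∧
      (∀ i j, b j ≤ b i → Finsupp.single j 1 ∈ Λ → Finsupp.single i 1 ∈ Λ) ∧
      ∀ (μ : ℕ → Measure (Icc (-1 : ℝ) 1)) [∀ j, IsProbabilityMeasure (μ j)]
        [∀ j, NullSingletonClass (μ j)],
        ∀ f ∈ unitClass b, AEStronglyMeasurable f (Measure.infinitePi μ) →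
          ∃ d : (ℕ →₀ ℕ) → ℝ,
            eLpNorm (fun y => f y - ∑ ν ∈ Λ, d ν * monomial ν y) 2 (Measure.infinitePi μ) ≤
              ENNReal.ofReal (C * (s : ℝ) ^ (1 / 2 - 1 / p)) := by
  have hb0 j : 0 ≤ b j := (hb j).le
  obtain ⟨C, hC, hmain⟩ := exists_superlevel_finset (coeffWeight_nonneg b) hp (by linarith)
    (summable_coeffWeight_rpow hb hp hp1 (summable_rpow_of_memℓp hb0 hp hbp))
  refine ⟨C, hC, fun s hs => ?_⟩
  obtain ⟨Λ, hcard, hup, htail⟩ := hmain s hs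
  have hlower : IsLowerSet (Λ : Set (ℕ →₀ ℕ)) := fun ν η hην hν =>
    hup ν hν η (coeffWeight_antitone b hην)
  refine ⟨Λ, hcard, hlower, fun i j hij hj => hup _ hj _ (coeffWeight_single_le hij 1), ?_⟩
  intro μ _ _ f hf hm
  have hmem : MemLp f 2 (Measure.infinitePi μ) :=
    MemLp.of_bound hm 1 (ae_of_all _ (abs_le_one_of_mem_unitClass hf))
  refine exists_eLpNorm_sub_sum_monomial_le μ hlower hmem (by positivity) fun u hu => ?_
  refine (Finset.sum_le_sum fun ν _ => ?_).trans (htail u hu)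
  exact sq_le_sq.2 ((abs_integral_mul_tensorPolynomial_le_coeffWeight hb0 hf μ hm ν).trans
    (le_abs_self _))

end PolynomialApproximation

section Variables

variable {Λ : Finset (ℕ →₀ ℕ)} (hΛ : IsLowerSet (Λ : Set (ℕ →₀ ℕ)))

include hΛ

theorem degree_lt_card {ν : ℕ →₀ ℕ} (hν : ν ∈ Λ) : ν.degree < Λ.card := by
  have hsurj : SurjOn Finsupp.degree (Λ : Set (ℕ →₀ ℕ)) (Finset.range (ν.degree + 1)) :=
    fun n hn => by
      obtain ⟨η, hη, rfl⟩ := Finsupp.exists_le_degree_eq ν n (Finset.mem_range_succ_iff.1 hn)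
      exact ⟨η, hΛ hη hν, rfl⟩
  exact Nat.lt_of_succ_le <|
    (Finset.card_range _).symm.trans_le (Finset.card_le_card_of_surjOn _ hsurj)

theorem single_mem_of_mem_support {ν : ℕ →₀ ℕ} (hν : ν ∈ Λ) {j : ℕ} (hj : j ∈ ν.support) :
    Finsupp.single j 1 ∈ Λ :=
  hΛ (Finsupp.single_le_iff.2 (Nat.one_le_iff_ne_zero.2 (Finsupp.mem_support_iff.1 hj))) hν

omit hΛ in
theorem card_le_card_of_single_mem {S : Finset ℕ} (h : ∀ j ∈ S, Finsupp.single j 1 ∈ Λ) :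
    S.card ≤ Λ.card :=
  Finset.card_le_card_of_injOn (fun j => Finsupp.single j 1) h
    (Finsupp.single_left_injective one_ne_zero).injOn

theorem support_subset_range_card
    (hanchor : ∀ i j, i ≤ j → Finsupp.single j 1 ∈ Λ → Finsupp.single i 1 ∈ Λ)
    {ν : ℕ →₀ ℕ} (hν : ν ∈ Λ) : ν.support ⊆ Finset.range Λ.card := fun j hj => by
  have hcard := card_le_card_of_single_mem (S := Finset.range (j + 1)) fun i hi =>
    hanchor i j (Finset.mem_range_succ_iff.1 hi) (single_mem_of_mem_support hΛ hν hj)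
  rw [Finset.card_range] at hcard
  exact Finset.mem_range.2 hcard

theorem exists_variables {s : ℕ} (hcard : Λ.card ≤ s) {P : Prop}
    (hP : P → ∀ i j, i ≤ j → Finsupp.single j 1 ∈ Λ → Finsupp.single i 1 ∈ Λ) :
    ∃ Θ : Finset ℕ, Θ.card = s ∧ (P → Θ = Finset.range s) ∧ ∀ ν ∈ Λ, ν.support ⊆ Θ := by
  by_cases h : P
  · exact ⟨Finset.range s, Finset.card_range s, fun _ => rfl, fun ν hν =>
      (support_subset_range_card hΛ (hP h) hν).trans (Finset.range_subset_range.2 hcard)⟩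
  · have hvars : (Λ.biUnion Finsupp.support).card ≤ Λ.card :=
      card_le_card_of_single_mem fun j hj => by
        obtain ⟨ν, hν, hjν⟩ := Finset.mem_biUnion.1 hj
        exact single_mem_of_mem_support hΛ hν hjν
    obtain ⟨Θ, hΘ, hΘs⟩ := Infinite.exists_superset_card_eq _ s (hvars.trans hcard)
    exact ⟨Θ, hΘs, fun hp => absurd hp h, fun ν hν =>
      (Finset.subset_biUnion_of_mem Finsupp.support hν).trans hΘ⟩

end Variables

section RestrictVars

variable {Θ : Finset ℕ} {s : ℕ} (hΘ : Θ.card = s)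

theorem prod_orderEmbOfFin {M : Type*} [CommMonoid M] (g : ℕ → M) :
    ∏ i, g (Θ.orderEmbOfFin hΘ i) = ∏ j ∈ Θ, g j := by
  conv_rhs => rw [← Finset.map_orderEmbOfFin_univ Θ hΘ, Finset.prod_map]
  rfl

theorem prod_restrictVars_pow {ν : ℕ →₀ ℕ} (hν : ν.support ⊆ Θ) (y : Cube) :
    ∏ i, restrictVars Θ hΘ y i ^ ν (Θ.orderEmbOfFin hΘ i) = monomial ν y := by
  rw [monomial_apply, Finsupp.prod_of_support_subset ν hν _ fun _ _ => pow_zero _]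
  exact prod_orderEmbOfFin hΘ fun j => (y j : ℝ) ^ ν j

theorem sum_orderEmbOfFin_eq_degree {ν : ℕ →₀ ℕ} (hν : ν.support ⊆ Θ) :
    ∑ i, ν (Θ.orderEmbOfFin hΘ i) = ν.degree := by
  rw [Finsupp.degree_apply, Finset.sum_subset hν fun _ _ => Finsupp.notMem_support_iff.1]
  exact Multiplicative.ofAdd.injective <| prod_orderEmbOfFin hΘ fun j => Multiplicative.ofAdd (ν j)

theorem norm_restrictVars_le (y : Cube) : ‖restrictVars Θ hΘ y‖ ≤ 1 :=
  (pi_norm_le_iff_of_nonneg zero_le_one).2 fun _ => abs_le.2 (y _).2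

end RestrictVars

section NetworkApproximation

theorem eLpNorm_sub_le_add {α : Type*} [MeasurableSpace α] {μ : Measure α}
    [IsProbabilityMeasure μ] {p : ℝ≥0∞} (hp : 1 ≤ p) {f g q : α → ℝ}
    (hm : AEStronglyMeasurable (fun y => f y - q y) μ) {ε : ℝ} (hε : ∀ y, |g y - q y| ≤ ε) :
    eLpNorm (fun y => f y - g y) p μ ≤ eLpNorm (fun y => f y - q y) p μ + ENNReal.ofReal ε := by
  have hle y : ‖f y - g y‖ ≤ ‖f y - q y‖ + ε :=
    (norm_sub_le_norm_sub_add_norm_sub _ (q y) _).trans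
      (add_le_add le_rfl ((norm_sub_rev _ _).trans_le (hε y)))
  have hε0 : 0 ≤ ε := (abs_nonneg _).trans (hε μ.nonempty_of_neZero.some)
  calc eLpNorm (fun y => f y - g y) p μ
      ≤ eLpNorm ((fun y => ‖f y - q y‖) + fun _ => ε) p μ := eLpNorm_mono_real hle
    _ ≤ eLpNorm (fun y => ‖f y - q y‖) p μ + eLpNorm (fun _ => ε) p μ :=
      eLpNorm_add_le hm.norm aestronglyMeasurable_const hp
    _ = eLpNorm (fun y => f y - q y) p μ + ENNReal.ofReal ε := by
      rw [eLpNorm_norm, eLpNorm_const _ (one_pos.trans_le hp).ne' (IsProbabilityMeasure.ne_zero μ),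
        measure_univ, ENNReal.one_rpow, mul_one, Real.enorm_eq_ofReal hε0]

theorem exists_realization_approximation {b : ℕ → ℝ} (hb : ∀ j, 0 < b j) {p : ℝ} (hp : 0 < p)
    (hp1 : p ≤ 1) (hbp : Memℓp b (ENNReal.ofReal p)) :
    ∃ C : ℝ, ∀ (s : ℕ) (hs : s ≠ 0), ∃ (Θ : Finset ℕ) (hΘ : Θ.card = s),
      (Antitone b → Θ = Finset.range s) ∧
      ∀ σ, HasNonzeroCurvature σ →
        ∀ (μ : ℕ → Measure (Icc (-1 : ℝ) 1)) [∀ j, IsProbabilityMeasure (μ j)]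
        [∀ j, NullSingletonClass (μ j)],
        ∀ f ∈ unitClass b, AEStronglyMeasurable f (Measure.infinitePi μ) →
          ∃ Φ ∈ realizations σ 1 s (treeArchitecture s hs).hidden,
            eLpNorm (fun y => f y - Φ (restrictVars Θ hΘ y) 0) 2 (Measure.infinitePi μ) ≤
              ENNReal.ofReal (C * (s : ℝ) ^ (1 / 2 - 1 / p)) := by
  obtain ⟨C, hC, hmain⟩ := exists_sum_monomial_approximation hb hp hp1 hbp
  refine ⟨C + 1, fun s hs => ?_⟩
  obtain ⟨Λ, hcard, hlower, hanchor, hpoly⟩ := hmain s hs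
  obtain ⟨Θ, hΘ, hrange, hsupp⟩ :=
    exists_variables hlower hcard fun (hanti : Antitone b) i j hij => hanchor i j (hanti hij)
  refine ⟨Θ, hΘ, hrange, fun σ hσ μ _ _ f hf hm => ?_⟩
  obtain ⟨d, hd⟩ := hpoly μ f hf hm
  have hdegree ν (hν : ν ∈ Λ) : ∑ i, ν (Θ.orderEmbOfFin hΘ i) ≤ 2 ^ Nat.clog 2 s := by
    rw [sum_orderEmbOfFin_eq_degree hΘ (hsupp ν hν)]
    exact ((degree_lt_card hlower hν).le.trans hcard).trans (Nat.le_pow_clog one_lt_two s)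
  have hrate : 0 < (s : ℝ) ^ (1 / 2 - 1 / p) := by positivity
  obtain ⟨Φ, hΦ, happrox⟩ := exists_approx_sum_monomials hσ Λ hcard _ hdegree d 1 hrate
  have hclose y : |Φ (restrictVars Θ hΘ y) 0 - ∑ ν ∈ Λ, d ν * monomial ν y| ≤
      (s : ℝ) ^ (1 / 2 - 1 / p) := by
    rw [← Finset.sum_congr rfl fun ν hν =>
      congrArg (d ν * ·) (prod_restrictVars_pow hΘ (hsupp ν hν) y)]
    exact happrox _ (norm_restrictVars_le hΘ y)
  refine ⟨Φ, hΦ, (eLpNorm_sub_le_add one_le_two (hm.sub ?_) hclose).trans ?_⟩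
  · exact (continuous_finsetSum _ fun ν _ =>
      continuous_const.mul (monomial ν).continuous).aestronglyMeasurable
  · rw [add_one_mul, ENNReal.ofReal_add (by positivity) hrate.le]
    gcongr

end NetworkApproximation

section MonotoneMajorant

variable {b : ℕ → ℝ}

theorem bddAbove_range_abs (hb : Memℓp b ∞) (i : ℕ) : BddAbove (range fun j : Ici i => |b j|) :=
  (memℓp_infty_iff.1 hb).mono (range_comp_subset_range Subtype.val fun j => ‖b j‖)

theorem abs_le_monotoneMajorant (hb : Memℓp b ∞) (i : ℕ) : |b i| ≤ monotoneMajorant b i :=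
  le_ciSup (bddAbove_range_abs hb i) ⟨i, self_mem_Ici⟩

theorem antitone_monotoneMajorant (hb : Memℓp b ∞) : Antitone (monotoneMajorant b) :=
  fun i _ hik => ciSup_le fun j =>
    le_ciSup (bddAbove_range_abs hb i) ⟨j, mem_Ici.2 (hik.trans j.2)⟩

theorem memℓp_half_pow {p : ℝ} (hp : 0 < p) :
    Memℓp (fun j : ℕ => (1 / 2 : ℝ) ^ j) (ENNReal.ofReal p) := by
  have hgeom : Summable fun j : ℕ => ((1 / 2 : ℝ) ^ p) ^ j :=
    summable_geometric_of_lt_one (by positivity) (Real.rpow_lt_one (by norm_num) (by norm_num) hp)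
  refine memℓp_gen (hgeom.congr fun j => ?_)
  rw [ENNReal.toReal_ofReal hp.le, Real.norm_of_nonneg (by positivity),
    Real.rpow_pow_comm (by norm_num)]

theorem exists_positive_majorant {p : ℝ} (hp : 0 < p) (hbp : Memℓp b (ENNReal.ofReal p)) :
    ∃ b' : ℕ → ℝ, (∀ j, |b j| ≤ b' j) ∧ (∀ j, 0 < b' j) ∧ Memℓp b' (ENNReal.ofReal p) ∧
      (MemMonotoneLp b p → Antitone b') := by
  obtain ⟨m, hm, hmp, hanti⟩ : ∃ m : ℕ → ℝ, (∀ j, |b j| ≤ m j) ∧ Memℓp m (ENNReal.ofReal p) ∧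
      (MemMonotoneLp b p → Antitone m) := by
    by_cases h : MemMonotoneLp b p
    · exact ⟨monotoneMajorant b, abs_le_monotoneMajorant h.1, h.2,
        fun _ => antitone_monotoneMajorant h.1⟩
    · exact ⟨fun j => ‖b j‖, fun _ => le_rfl, hbp.norm, fun h' => absurd h' h⟩
  have hpos (j : ℕ) : 0 < (1 / 2 : ℝ) ^ j := by positivity
  exact ⟨fun j => m j + (1 / 2) ^ j, fun j => (hm j).trans (by linarith [hpos j]),
    fun j => by linarith [hpos j, abs_nonneg (b j), hm j], hmp.add (memℓp_half_pow hp),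
    fun h => (hanti h).add (pow_right_anti₀ (by norm_num) (by norm_num))⟩

end MonotoneMajorant

instance : NullSingletonClass unif where
  measure_singleton x := by
    rw [unif, Measure.smul_apply, comap_subtype_coe_apply measurableSet_Icc, image_singleton,
      Real.volume_singleton, smul_zero]

end HoloDNN

theorem mainTheorem4_general :
    ∃ c₁ > (0 : ℝ), ∃ c₂ > (0 : ℝ),
      ∀ (p : ℝ), 0 < p → p ≤ 1 → ∀ (b : ℕ → ℝ), Memℓp b (ENNReal.ofReal p) →
      ∃ C : ℝ, ∀ s : ℕ, 1 ≤ s →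
        ∃ (Θ : Finset ℕ) (hΘ : Θ.card = s) (a : HoloDNN.Architecture),
          (HoloDNN.MemMonotoneLp b p → Θ = Finset.range s) ∧
          (a.width : ℝ) ≤ c₁ * (s : ℝ) ^ 2 ∧
          (a.depth : ℝ) ≤ c₂ * Real.log s ∧
          ∀ σ, HoloDNN.HasNonzeroCurvature σ →
            ∀ (μ : ℕ → Measure (Icc (-1 : ℝ) 1)) [∀ j, IsProbabilityMeasure (μ j)]
            [∀ j, NullSingletonClass (μ j)],
            ∀ f ∈ HoloDNN.unitClass b, AEStronglyMeasurable f (Measure.infinitePi μ) →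
              ∃ Φ ∈ HoloDNN.realizations σ 1 s a.hidden,
                eLpNorm (fun y => f y - Φ (HoloDNN.restrictVars Θ hΘ y) 0) 2
                    (Measure.infinitePi μ) ≤
                  ENNReal.ofReal (C * (s : ℝ) ^ (1 / 2 - 1 / p)) := by
  refine ⟨4, four_pos, 2 / Real.log 2, div_pos two_pos (Real.log_pos one_lt_two), ?_⟩
  intro p hp hp1 b hbp
  obtain ⟨b', hle, hpos, hbp', hanti⟩ := HoloDNN.exists_positive_majorant hp hbp
  obtain ⟨C, hC⟩ := HoloDNN.exists_realization_approximation hpos hp hp1 hbp'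
  refine ⟨C, fun s hs => ?_⟩
  have hs : s ≠ 0 := Nat.one_le_iff_ne_zero.1 hs
  obtain ⟨Θ, hΘ, hrange, happrox⟩ := hC s hs
  exact ⟨Θ, hΘ, HoloDNN.treeArchitecture s hs, fun h => hrange (hanti h),
    HoloDNN.width_treeArchitecture_le hs, HoloDNN.depth_treeArchitecture_le hs,
    fun σ hσ μ _ _ f hf hm => happrox σ hσ μ f (HoloDNN.unitClass_mono hle hf) hm⟩

theorem mainTheorem4 :
    ∃ c₁ > (0 : ℝ), ∃ c₂ > (0 : ℝ),
      ∀ (p : ℝ), 0 < p → p < 1 →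
      ∀ (b : ℕ → ℝ), (∀ j, 0 ≤ b j) → Memℓp b (ENNReal.ofReal p) →
      ∃ C : ℝ, ∀ s : ℕ, 1 ≤ s →
        ∃ (Θ : Finset ℕ) (hΘ : Θ.card = s) (a : HoloDNN.Architecture),
          (HoloDNN.MemMonotoneLp b p → Θ = Finset.range s) ∧
          (a.width : ℝ) ≤ c₁ * (s : ℝ) ^ 2 ∧
          (a.depth : ℝ) ≤ c₂ * Real.log s ∧
          ∀ f ∈ HoloDNN.unitClass b, AEStronglyMeasurable f HoloDNN.rho →
            ∃ Φ ∈ HoloDNN.tanhDNN s 1 a,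
              eLpNorm (fun y => f y - Φ (HoloDNN.restrictVars Θ hΘ y) 0) 2 HoloDNN.rho
                ≤ ENNReal.ofReal (C * (s : ℝ) ^ (1 / 2 - 1 / p)) := by
  obtain ⟨c₁, hc₁, c₂, hc₂, h⟩ := mainTheorem4_general
  refine ⟨c₁, hc₁, c₂, hc₂, fun p hp hp1 b _ hbp => ?_⟩
  obtain ⟨C, hC⟩ := h p hp hp1.le b hbp
  refine ⟨C, fun s hs => ?_⟩
  obtain ⟨Θ, hΘ, a, hrange, hwidth, hdepth, happrox⟩ := hC s hs
  exact ⟨Θ, hΘ, a, hrange, hwidth, hdepth,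
    happrox Real.tanh HoloDNN.hasNonzeroCurvature_tanh fun _ => HoloDNN.unif⟩
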